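/- Let $d\ge 1$ and let $\Omega\subseteq\mathbb{R}^d$ be a non-empty bounded open set. Let $a\colon\Omega\to\mathbb{R}^{d\times d}$ be measurable and symmetric, with $\lambda|\xi|^2\le \xi\cdot a(x)\xi\le\Lambda|\xi|^2$ for almost every $x\in\Omega$ and all $\xi\in\mathbb{R}^d$, for some $\lambda,\Lambda>0$, and let $q\colon\Omega\to\mathbb{R}$ be measurable with $\beta_1\le q\le\beta_2$ almost everywhere in $\Omega$, for some $\beta_1,\beta_2>0$. Let $H^1_0(\Omega;\mathbb{C})$ be the closure of $C_c^\infty(\Omega;\mathbb{C})$ in $H^1(\Omega;\mathbb{C})$, with the $H^1$ norm, and let $H^{-1}(\Omega;\mathbb{C})$ be its continuous antidual. For $k\in\mathbb{C}$ and $f\in H^{-1}(\Omega;\mathbb{C})$, a solution $u\in H_0^1(\Omega;\mathbb{C})$ of $$-\operatorname{div}(a\nabla u)-k\,q\,u=f \qquad (1)$$ is understood in the weak sense, $\int_\Omega a\nabla u\cdot\overline{\nabla v}\,dx-k\int_\Omega q\,u\,\overline{v}\,dx=f(v)$ for all $v\in H^1_0(\Omega;\mathbb{C})$. Let $\Sigma$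 be the set of Dirichlet eigenvalues, that is, of the $k\in\mathbb{C}$ for which (1) with $f=0$ has a solution $u\neq0$ in $H^1_0(\Omega;\mathbb{C})$. Then $\Sigma=\{\lambda_i : i\in\mathbb{N}\}$ for a sequence of positive real numbers with $\lambda_i\to+\infty$, and: 1. for every $k\in\mathbb{C}\setminus\Sigma$ there is a constant $C>0$ such that for every $f\in H^{-1}(\Omega;\mathbb{C})$ equation (1) has a unique solution $u\in H^1_0(\Omega;\mathbb{C})$, and $\|u\|_{H^1_0}\le C\|f\|_{H^{-1}}$; 2. for every fixed $f\in H^{-1}(\Omega;\mathbb{C})$, the map $\mathbb{C}\setminus\Sigma\to H^1_0(\Omega;\mathbb{C})$, $k\mapsto u$, sending $k$ to the solution of (1), is analytic. -/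

import Mathlib

open MeasureTheory Filter Topology
open scoped ContDiff ComplexConjugate

namespace DirichletHelmholtz

/-- `φ ∈ C_c^∞(Ω; ℂ)`, as a function on the whole space. -/
structure IsTestFunction {d : ℕ} (Ω : Set (EuclideanSpace ℝ (Fin d)))
    (φ : EuclideanSpace ℝ (Fin d) → ℂ) : Prop where
  contDiff : ContDiff ℝ ∞ φ
  hasCompactSupport : HasCompactSupport φ
  tsupport_subset : tsupport φ ⊆ Ω

/-- The `i`-th partial derivative of `φ` at `x`. -/
noncomputable def partialDeriv {d : ℕ} (i : Fin d) (φ : EuclideanSpace ℝ (Fin d) → ℂ)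
    (x : EuclideanSpace ℝ (Fin d)) : ℂ :=
  fderiv ℝ φ x (EuclideanSpace.single i 1)

/-- `L²(Ω; ℂ)`. -/
abbrev L2 {d : ℕ} (Ω : Set (EuclideanSpace ℝ (Fin d))) : Type :=
  Lp ℂ 2 (volume.restrict Ω)

/-- `L²(Ω; ℂ^d)`. -/
abbrev L2Vec {d : ℕ} (Ω : Set (EuclideanSpace ℝ (Fin d))) : Type :=
  Lp (EuclideanSpace ℂ (Fin d)) 2 (volume.restrict Ω)

/-- `g` is the weak gradient of `u` in `Ω`: `∫_Ω u ∂ᵢφ = - ∫_Ω gᵢ φ` for all test functions `φ`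
and all `i`. (Both integrands are integrable, as products of square-integrable functions.) -/
def IsWeakGradient {d : ℕ} (Ω : Set (EuclideanSpace ℝ (Fin d))) (u : L2 Ω) (g : L2Vec Ω) : Prop :=
  ∀ φ : EuclideanSpace ℝ (Fin d) → ℂ, IsTestFunction Ω φ → ∀ i : Fin d,
    ∫ x in Ω, u x * partialDeriv i φ x = - ∫ x in Ω, g x i * φ x

theorem IsTestFunction.memLp {d : ℕ} {Ω : Set (EuclideanSpace ℝ (Fin d))}
    {φ : EuclideanSpace ℝ (Fin d) → ℂ} (h : IsTestFunction Ω φ) :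
    MemLp φ 2 (volume.restrict Ω) :=
  (h.contDiff.continuous.memLp_of_hasCompactSupport h.hasCompactSupport).restrict Ω

theorem IsTestFunction.memLp_partialDeriv {d : ℕ} {Ω : Set (EuclideanSpace ℝ (Fin d))}
    {φ : EuclideanSpace ℝ (Fin d) → ℂ} (h : IsTestFunction Ω φ) (i : Fin d) :
    MemLp (partialDeriv i φ) 2 (volume.restrict Ω) := by
  have hc : Continuous (partialDeriv i φ) :=
    (h.contDiff.continuous_fderiv (by simp)).clm_apply continuous_const
  have hs : HasCompactSupport (partialDeriv i φ) :=
    h.hasCompactSupport.fderiv_apply ℝ (EuclideanSpace.single i 1)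
  exact (hc.memLp_of_hasCompactSupport hs).restrict Ω

theorem integrable_mul_partialDeriv {d : ℕ} {Ω : Set (EuclideanSpace ℝ (Fin d))} (u : L2 Ω)
    {φ : EuclideanSpace ℝ (Fin d) → ℂ} (h : IsTestFunction Ω φ) (i : Fin d) :
    Integrable (fun x => u x * partialDeriv i φ x) (volume.restrict Ω) :=
  (Lp.memLp u).integrable_mul (h.memLp_partialDeriv i)

theorem integrable_coord_mul {d : ℕ} {Ω : Set (EuclideanSpace ℝ (Fin d))} (g : L2Vec Ω)
    {φ : EuclideanSpace ℝ (Fin d) → ℂ} (h : IsTestFunction Ω φ) (i : Fin d) :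
    Integrable (fun x => g x i * φ x) (volume.restrict Ω) :=
  ((EuclideanSpace.proj (𝕜 := ℂ) i).comp_memLp' (Lp.memLp g)).integrable_mul h.memLp

/-- `H¹(Ω; ℂ)`: the pairs `(u, ∇u)` with `u ∈ L²(Ω; ℂ)` having a weak gradient
`∇u ∈ L²(Ω; ℂ^d)`. As a weak gradient is unique, such a pair is the same as the function `u`.
The norm is `‖u‖_{H¹}² = ‖u‖_{L²}² + ‖∇u‖_{L²}²`. -/
noncomputable def H1 {d : ℕ} (Ω : Set (EuclideanSpace ℝ (Fin d))) :
    Submodule ℂ (WithLp 2 (L2 Ω × L2Vec Ω)) where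
  carrier := {p | IsWeakGradient Ω p.fst p.snd}
  zero_mem' := by
    intro φ hφ i
    have h1 : ∫ x in Ω, (0 : L2 Ω) x * partialDeriv i φ x = 0 := by
      rw [← integral_zero (EuclideanSpace ℝ (Fin d)) ℂ (μ := volume.restrict Ω)]
      refine integral_congr_ae ?_
      filter_upwards [Lp.coeFn_zero ℂ 2 (volume.restrict Ω)] with x hx
      rw [hx]; simp
    have h2 : ∫ x in Ω, (0 : L2Vec Ω) x i * φ x = 0 := by
      rw [← integral_zero (EuclideanSpace ℝ (Fin d)) ℂ (μ := volume.restrict Ω)]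
      refine integral_congr_ae ?_
      filter_upwards [Lp.coeFn_zero (EuclideanSpace ℂ (Fin d)) 2 (volume.restrict Ω)] with x hx
      rw [hx]; simp
    simp only [WithLp.zero_fst, WithLp.zero_snd]
    rw [h1, h2, neg_zero]
  add_mem' := by
    intro p r hp hr φ hφ i
    have h1 : ∫ x in Ω, (p.fst + r.fst) x * partialDeriv i φ x =
        (∫ x in Ω, p.fst x * partialDeriv i φ x) + ∫ x in Ω, r.fst x * partialDeriv i φ x := by
      rw [← integral_add (integrable_mul_partialDeriv _ hφ i) (integrable_mul_partialDeriv _ hφ i)]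
      refine integral_congr_ae ?_
      filter_upwards [Lp.coeFn_add p.fst r.fst] with x hx
      rw [hx]; simp [add_mul]
    have h2 : ∫ x in Ω, (p.snd + r.snd) x i * φ x =
        (∫ x in Ω, p.snd x i * φ x) + ∫ x in Ω, r.snd x i * φ x := by
      rw [← integral_add (integrable_coord_mul _ hφ i) (integrable_coord_mul _ hφ i)]
      refine integral_congr_ae ?_
      filter_upwards [Lp.coeFn_add p.snd r.snd] with x hx
      rw [hx]; simp [add_mul]
    simp only [WithLp.add_fst, WithLp.add_snd]
    rw [h1, h2, hp φ hφ i, hr φ hφ i, neg_add]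
  smul_mem' := by
    intro c p hp φ hφ i
    have h1 : ∫ x in Ω, (c • p.fst) x * partialDeriv i φ x =
        c * ∫ x in Ω, p.fst x * partialDeriv i φ x := by
      rw [← integral_const_mul]
      refine integral_congr_ae ?_
      filter_upwards [Lp.coeFn_smul c p.fst] with x hx
      rw [hx]; simp [mul_assoc]
    have h2 : ∫ x in Ω, (c • p.snd) x i * φ x = c * ∫ x in Ω, p.snd x i * φ x := by
      rw [← integral_const_mul]
      refine integral_congr_ae ?_
      filter_upwards [Lp.coeFn_smul c p.snd] with x hx
      rw [hx]; simp [mul_assoc]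
    simp only [WithLp.smul_fst, WithLp.smul_snd]
    rw [h1, h2, hp φ hφ i, mul_neg]

/-- The elements of `H¹(Ω; ℂ)` that are (represented by) test functions. -/
noncomputable def testSubspace {d : ℕ} (Ω : Set (EuclideanSpace ℝ (Fin d))) :
    Submodule ℂ (H1 Ω) where
  carrier := {w | ∃ φ : EuclideanSpace ℝ (Fin d) → ℂ, IsTestFunction Ω φ ∧
    w.1.fst =ᵐ[volume.restrict Ω] φ}
  zero_mem' :=
    ⟨fun _ => 0, ⟨contDiff_const, HasCompactSupport.zero, by simp [tsupport]⟩,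
      Lp.coeFn_zero ℂ 2 (volume.restrict Ω)⟩
  add_mem' := by
    rintro w z ⟨φ, hφ, hw⟩ ⟨ψ, hψ, hz⟩
    refine ⟨φ + ψ, ⟨hφ.contDiff.add hψ.contDiff,
      hφ.hasCompactSupport.add hψ.hasCompactSupport, ?_⟩, ?_⟩
    · exact (tsupport_add φ ψ).trans (Set.union_subset hφ.tsupport_subset hψ.tsupport_subset)
    · exact (Lp.coeFn_add w.1.fst z.1.fst).trans (hw.add hz)
  smul_mem' := by
    rintro c w ⟨φ, hφ, hw⟩
    refine ⟨c • φ, ⟨hφ.contDiff.const_smul c, hφ.hasCompactSupport.smul_left (f := fun _ => c), ?_⟩,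
      ?_⟩
    · exact (tsupport_smul_subset_right (fun _ => c) φ).trans hφ.tsupport_subset
    · exact (Lp.coeFn_smul c w.1.fst).trans (hw.const_smul c)

/-- `H¹₀(Ω; ℂ)`: the closure of `C_c^∞(Ω; ℂ)` in `H¹(Ω; ℂ)`, with the norm of `H¹(Ω; ℂ)`. -/
noncomputable def H10 {d : ℕ} (Ω : Set (EuclideanSpace ℝ (Fin d))) : Submodule ℂ (H1 Ω) :=
  (testSubspace Ω).topologicalClosure

/-- The function `u ∈ L²(Ω; ℂ)` underlying `u ∈ H¹₀(Ω; ℂ)`. -/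
noncomputable def fn {d : ℕ} {Ω : Set (EuclideanSpace ℝ (Fin d))} (u : H10 Ω) : L2 Ω :=
  u.1.1.fst

/-- The weak gradient `∇u ∈ L²(Ω; ℂ^d)` of `u ∈ H¹₀(Ω; ℂ)`. -/
noncomputable def grad {d : ℕ} {Ω : Set (EuclideanSpace ℝ (Fin d))} (u : H10 Ω) : L2Vec Ω :=
  u.1.1.snd

/-- `H⁻¹(Ω; ℂ)`: the continuous antidual of `H¹₀(Ω; ℂ)`, that is, the bounded conjugate-linear
functionals, with the operator norm. -/
abbrev HMinusOne {d : ℕ} (Ω : Set (EuclideanSpace ℝ (Fin d))) : Type :=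
  H10 Ω →L⋆[ℂ] ℂ

/-- `u ∈ H¹₀(Ω; ℂ)` satisfies `-div(a ∇u) - k q u = f` in `H⁻¹(Ω; ℂ)`: for all `v ∈ H¹₀(Ω; ℂ)`,
`∫_Ω a ∇u · conj(∇v) - k ∫_Ω q u conj(v) = f(v)`. -/
def IsWeakSolution {d : ℕ} (Ω : Set (EuclideanSpace ℝ (Fin d)))
    (a : EuclideanSpace ℝ (Fin d) → Matrix (Fin d) (Fin d) ℝ) (q : EuclideanSpace ℝ (Fin d) → ℝ)
    (k : ℂ) (f : HMinusOne Ω) (u : H10 Ω) : Prop :=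
  ∀ v : H10 Ω,
    (∫ x in Ω, ∑ i, ∑ j, (a x i j : ℂ) * grad u x j * conj (grad v x i))
      - k * ∫ x in Ω, (q x : ℂ) * fn u x * conj (fn v x) = f v

/-- The set of the Dirichlet eigenvalues: the `k ∈ ℂ` for which `-div(a ∇u) = k q u` has a
solution `u ∈ H¹₀(Ω; ℂ)`, `u ≠ 0`. -/
def dirichletEigenvalues {d : ℕ} (Ω : Set (EuclideanSpace ℝ (Fin d)))
    (a : EuclideanSpace ℝ (Fin d) → Matrix (Fin d) (Fin d) ℝ)
    (q : EuclideanSpace ℝ (Fin d) → ℝ) : Set ℂ :=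
  {k | ∃ u : H10 Ω, u ≠ 0 ∧ IsWeakSolution Ω a q k 0 u}

end DirichletHelmholtz

/-!
In the Hilbert space `H = H¹₀(Ω)`, the equation reads `(A - k S) u = g`, where `A` represents the
energy form `∫ a ∇u · conj ∇v`, `S` represents `∫ q u conj v`, and `g` is the Riesz representative
of `f`. The theorem is then an assertion about the operator pencil `A - k S`
(`exists_spectral_alternative`), which holds because:

* `A` is symmetric and coercive. Coercivity is ellipticity together with the Poincaré inequality
  (`DirichletHelmholtz.exists_poincare`).
* `S` is symmetric, nonnegative and injective, as `q ≥ β₁ > 0`, and it is compact by Rellich's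
  theorem (`DirichletHelmholtz.isCompactOperator_fnL_comp_subtypeL`).
* `H` is infinite-dimensional.

With `B = √A` one has `A - k S = B (1 - k T) B`, where `T = B⁻¹ S B⁻¹` is compact, self-adjoint and
injective. So `k ≠ 0` is an eigenvalue of the pencil exactly when `k⁻¹` is an eigenvalue of `T`, and
otherwise `A - k S` is invertible by the Fredholm alternative. The spectral theorem gives infinitely
many eigenvalues of `T`, only finitely many of them outside each neighbourhood of `0`; this is the
sequence tending to infinity. Analyticity is that of operator inversion.

Both Poincaré and Rellich come from the translation estimate
`∫ |φ(x + z) - φ(x)|² dx ≤ |z|² ∫ |∇φ|²` for test functions `φ`. For Poincaré, take `z` so long that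
`Ω` and `Ω + z` are disjoint. For Rellich, integrating over small `z` shows that `φ` is within
`C δ ‖∇φ‖` in `L²` of its averages over the cubes of a grid of side `δ`, so that the inclusion
`H¹₀(Ω) → L²(Ω)` is a norm limit of finite-rank operators.
-/

/-! ### Compact self-adjoint operators and operator pencils -/

/-- The Riesz representation theorem for bounded conjugate-linear functionals. -/
theorem exists_inner_eq_antidual {H : Type*} [NormedAddCommGroup H] [InnerProductSpace ℂ H]
    [CompleteSpace H] (f : H →L⋆[ℂ] ℂ) :
    ∃ g : H, (∀ v, inner ℂ v g = f v) ∧ ‖g‖ ≤ ‖f‖ := by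
  let F : H →L[ℂ] ℂ := (starL ℂ : ℂ ≃L⋆[ℂ] ℂ).toContinuousLinearMap.comp f
  let g := (InnerProductSpace.toDual ℂ H).symm F
  have hg : ∀ v, inner ℂ v g = f v := by
    intro v
    rw [← inner_conj_symm, InnerProductSpace.toDual_symm_apply]
    exact Complex.conj_conj (f v)
  refine ⟨g, hg, ?_⟩
  rcases (norm_nonneg g).eq_or_lt with h | h
  · rw [← h]; exact norm_nonneg f
  · have h1 : ‖g‖ * ‖g‖ ≤ ‖f‖ * ‖g‖ := by
      rw [← inner_self_eq_norm_mul_norm (𝕜 := ℂ), hg]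
      exact (Complex.re_le_norm _).trans (f.le_opNorm g)
    exact le_of_mul_le_mul_right h1 h

section Abstract
variable {H : Type*} [NormedAddCommGroup H] [InnerProductSpace ℂ H]

/-- Unit eigenvectors for distinct eigenvalues of modulus at least `ε` have images at mutual
distance at least `ε`, so there cannot be infinitely many of them. -/
theorem IsCompactOperator.finite_setOf_hasEigenvalue {T : H →L[ℂ] H} (hT : IsCompactOperator T)
    (hT' : T.IsSymmetric) {ε : ℝ} (hε : 0 < ε) :
    {μ : ℂ | Module.End.HasEigenvalue (T : Module.End ℂ H) μ ∧ ε ≤ ‖μ‖}.Finite := by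
  by_contra hinf
  have hinf : Set.Infinite _ := hinf
  let m : ℕ ↪ _ := hinf.natEmbedding
  have hex : ∀ n, ∃ e : H, ‖e‖ = 1 ∧ T e = (m n : ℂ) • e := by
    intro n
    obtain ⟨v, hv⟩ := (m n).2.1.exists_hasEigenvector
    have hv0 : ‖v‖ ≠ 0 := norm_ne_zero_iff.mpr hv.2
    refine ⟨((‖v‖⁻¹ : ℝ) : ℂ) • v, ?_, ?_⟩
    · rw [norm_smul]; simp [hv0]
    · have : T v = (m n : ℂ) • v := hv.apply_eq_smul
      rw [map_smul, this, smul_comm]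
  choose e he1 heT using hex
  have horth : ∀ i j, i ≠ j → inner ℂ (T (e i)) (T (e j)) = 0 := by
    intro i j hij
    have hne : (m i : ℂ) ≠ m j := fun h => hij (m.injective (Subtype.ext h))
    have h0 := hT'.orthogonalFamily_eigenspaces hne
      ⟨e i, Module.End.mem_eigenspace_iff.mpr (heT i)⟩
      ⟨e j, Module.End.mem_eigenspace_iff.mpr (heT j)⟩
    have h1 : inner ℂ (e i) (e j) = 0 := h0
    rw [heT, heT, inner_smul_left, inner_smul_right, h1]; simp
  have hfar : ∀ i j, i ≠ j → ε ≤ ‖T (e i) - T (e j)‖ := by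
    intro i j hij
    have h1 : ‖T (e i) - T (e j)‖ ^ 2 = ‖T (e i)‖ ^ 2 + ‖T (e j)‖ ^ 2 := by
      rw [@norm_sub_sq ℂ, horth i j hij]; simp
    have h2 : ε ≤ ‖T (e i)‖ := by
      rw [heT, norm_smul, he1, mul_one]; exact (m i).2.2
    refine le_of_sq_le_sq ?_ (norm_nonneg _)
    rw [h1]; nlinarith [sq_nonneg ‖T (e j)‖]
  obtain ⟨K, hK, hK'⟩ := hT.image_closedBall_subset_compact (1 : ℝ)
  obtain ⟨y, -, ψ, hψ, hψy⟩ := hK.tendsto_subseq (fun n => hK' ⟨e n, by simp [he1], rfl⟩)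
  obtain ⟨N, hN⟩ := Metric.cauchySeq_iff'.mp hψy.cauchySeq ε hε
  have h3 := hN (N + 1) (Nat.le_succ N)
  rw [dist_eq_norm] at h3
  exact absurd h3 (not_lt.mpr (hfar _ _ (hψ.injective.ne (Nat.succ_ne_self N))))

/-- The eigenvalues of the pencil `A - k S`, that is, the `k` for which `A - k S` is not
injective. -/
def pencilEigenvalues (A S : H →L[ℂ] H) : Set ℂ := {k | ∃ u, u ≠ 0 ∧ A u = k • S u}

theorem inner_pencil (A S : H →L[ℂ] H) (k : ℂ) (u v : H) :
    inner ℂ v ((A - k • S) u) = inner ℂ v (A u) - k * inner ℂ v (S u) := by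
  rw [sub_apply, smul_apply, inner_sub_right, inner_smul_right]

theorem forall_inner_pencil_eq_zero_iff (A S : H →L[ℂ] H) (k : ℂ) (u : H) :
    (∀ v, inner ℂ v ((A - k • S) u) = (0 : H →L⋆[ℂ] ℂ) v) ↔ A u = k • S u := by
  rw [← sub_eq_zero, ← smul_apply, ← sub_apply]
  exact ⟨fun h => inner_self_eq_zero.mp (h _), fun h v => by rw [h]; exact inner_zero_right v⟩

theorem pencilEigenvalues_pos {A S : H →L[ℂ] H}
    (hA : A.IsPositive) {c : ℝ} (hc : 0 < c) (hAc : ∀ u, c * ‖u‖ ^ 2 ≤ (inner ℂ (A u) u).re)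
    (hS : S.IsPositive) {k : ℂ} (hk : k ∈ pencilEigenvalues A S) : ∃ r : ℝ, 0 < r ∧ k = r := by
  obtain ⟨u, hu, h⟩ := hk
  obtain ⟨s, hs⟩ : ∃ s : ℝ, inner ℂ u (S u) = s := by
    refine ⟨(inner ℂ u (S u)).re, ?_⟩
    have := hS.inner_nonneg_right u
    exact (Complex.eq_re_of_ofReal_le this)
  obtain ⟨t, ht⟩ : ∃ s : ℝ, inner ℂ u (A u) = s := by
    refine ⟨(inner ℂ u (A u)).re, ?_⟩
    have := hA.inner_nonneg_right u
    exact (Complex.eq_re_of_ofReal_le this)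
  have hs0 : 0 ≤ s := by have := hS.inner_nonneg_right u; rw [hs] at this; exact_mod_cast this
  have ht0 : 0 < t := by
    have h1 := hAc u
    rw [hA.inner_left_eq_inner_right, ht, Complex.ofReal_re] at h1
    have : 0 < ‖u‖ := norm_pos_iff.mpr hu
    exact lt_of_lt_of_le (by positivity) h1
  have hts : (t : ℂ) = k * s := by rw [← ht, h, inner_smul_right, hs]
  have hsne : s ≠ 0 := by
    rintro rfl
    simp at hts; exact ht0.ne' hts
  refine ⟨t / s, div_pos ht0 (lt_of_le_of_ne hs0 hsne.symm), ?_⟩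
  push_cast
  rw [hts, mul_div_cancel_right₀ _ (Complex.ofReal_ne_zero.mpr hsne)]

theorem mem_pencilEigenvalues_iff_hasEigenvalue_inv (B : (H →L[ℂ] H)ˣ) {T A S : H →L[ℂ] H}
    (hA : A = B * B) (hS : S = B * T * B) {k : ℂ} (hk : k ≠ 0) :
    k ∈ pencilEigenvalues A S ↔ Module.End.HasEigenvalue (T : Module.End ℂ H) k⁻¹ := by
  have h1 : ∀ u, (↑B⁻¹ : H →L[ℂ] H) ((B : H →L[ℂ] H) u) = u := fun u => by
    rw [← mul_apply_eq_comp]; simp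
  have h2 : ∀ u, (B : H →L[ℂ] H) ((↑B⁻¹ : H →L[ℂ] H) u) = u := fun u => by
    rw [← mul_apply_eq_comp]; simp
  constructor
  · rintro ⟨u, hu, h⟩
    refine Module.End.hasEigenvalue_of_hasEigenvector (x := (B : H →L[ℂ] H) u)
      ⟨Module.End.mem_eigenspace_iff.mpr ?_, ?_⟩
    · change T _ = _
      subst hA hS
      have h3 := congrArg (↑B⁻¹ : H →L[ℂ] H) h
      simp only [mul_apply_eq_comp, map_smul, h1] at h3
      rw [eq_inv_smul_iff₀ hk]
      exact h3.symm
    · intro h3; apply hu; rw [← h1 u, h3, map_zero]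
  · intro h
    obtain ⟨v, hv⟩ := h.exists_hasEigenvector
    have hTv : T v = k⁻¹ • v := hv.apply_eq_smul
    refine ⟨(↑B⁻¹ : H →L[ℂ] H) v, ?_, ?_⟩
    · intro h3; apply hv.2; rw [← h2 v, h3, map_zero]
    · subst hA hS
      simp only [mul_apply_eq_comp, h2, hTv, map_smul]
      rw [smul_smul, mul_inv_cancel₀ hk, one_smul]

variable [CompleteSpace H]

/-- By the spectral theorem the span of the eigenspaces is dense; with finitely many eigenvalues,
all nonzero, it would be finite-dimensional. -/
theorem IsCompactOperator.infinite_setOf_hasEigenvalue {T : H →L[ℂ] H} (hT : IsCompactOperator T)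
    (hT' : T.IsSymmetric) (hinj : Function.Injective T) (hH : ¬ FiniteDimensional ℂ H) :
    {μ : ℂ | Module.End.HasEigenvalue (T : Module.End ℂ H) μ}.Infinite := by
  intro hfin
  apply hH
  have h0 : ∀ μ, Module.End.HasEigenvalue (T : Module.End ℂ H) μ → μ ≠ 0 := by
    rintro μ hμ rfl
    obtain ⟨v, hv⟩ := hμ.exists_hasEigenvector
    have h1 : T v = (0 : ℂ) • v := hv.apply_eq_smul
    exact hv.2 (hinj (by simpa using h1))
  have hsup : (⨆ μ, Module.End.eigenspace (T : Module.End ℂ H) μ) =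
      ⨆ μ : {μ : ℂ | Module.End.HasEigenvalue (T : Module.End ℂ H) μ},
        Module.End.eigenspace (T : Module.End ℂ H) (μ : ℂ) := by
    apply le_antisymm
    · refine iSup_le fun μ => ?_
      by_cases hμ : Module.End.HasEigenvalue (T : Module.End ℂ H) μ
      · exact le_iSup (fun μ : {μ : ℂ | Module.End.HasEigenvalue (T : Module.End ℂ H) μ} =>
          Module.End.eigenspace (T : Module.End ℂ H) (μ : ℂ)) ⟨μ, hμ⟩
      · rw [Module.End.hasEigenvalue_iff, not_not] at hμ
        rw [hμ]; exact bot_le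
    · exact iSup_le fun μ => le_iSup (fun μ => Module.End.eigenspace (T : Module.End ℂ H) μ) μ
  have hbot := ContinuousLinearMap.orthogonalComplement_iSup_eigenspaces_eq_bot hT hT'
  rw [hsup] at hbot
  have : Finite {μ : ℂ | Module.End.HasEigenvalue (T : Module.End ℂ H) μ} := hfin
  have : ∀ μ : {μ : ℂ | Module.End.HasEigenvalue (T : Module.End ℂ H) μ},
      FiniteDimensional ℂ (Module.End.eigenspace (T : Module.End ℂ H) (μ : ℂ)) := fun μ =>
    ContinuousLinearMap.finite_dimensional_eigenspace hT μ (h0 μ μ.2)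
  have hfd := Submodule.finite_iSup fun μ :
    {μ : ℂ | Module.End.HasEigenvalue (T : Module.End ℂ H) μ} =>
    Module.End.eigenspace (T : Module.End ℂ H) (μ : ℂ)
  have htop := Submodule.orthogonal_eq_bot_iff.mp hbot
  rw [htop] at hfd
  exact Module.finite_def.mpr (Module.Finite.iff_fg.mp hfd)

/-- A pencil `A - k S` with `A` positive and invertible is congruent, through `B = √A`, to `1 - k T`
with `T = B⁻¹ S B⁻¹`, which is symmetric (unlike `A⁻¹ S`). -/
theorem exists_symmetrization {A S : H →L[ℂ] H} (hA : A.IsPositive) (hAu : IsUnit A)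
    (hS : S.IsSymmetric) (hSc : IsCompactOperator S) :
    ∃ (B : (H →L[ℂ] H)ˣ) (T : H →L[ℂ] H), T.IsSymmetric ∧ IsCompactOperator T ∧
      A = B * B ∧ S = B * T * B := by
  have hA0 : 0 ≤ A := (ContinuousLinearMap.nonneg_iff_isPositive A).mpr hA
  obtain ⟨B, hB⟩ := (CFC.isUnit_sqrt_iff A hA0).mpr hAu
  have hBsa : IsSelfAdjoint (B : H →L[ℂ] H) := by
    rw [hB]; exact (CFC.sqrt_nonneg A).isSelfAdjoint
  have hBinv : IsSelfAdjoint ((B⁻¹ : (H →L[ℂ] H)ˣ) : H →L[ℂ] H) := by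
    have : star B = B := Units.ext hBsa
    change star ((B⁻¹ : (H →L[ℂ] H)ˣ) : H →L[ℂ] H) = _
    rw [← Units.coe_star_inv, this]
  refine ⟨B, ↑B⁻¹ * S * ↑B⁻¹, ?_, ?_, ?_, ?_⟩
  · have := (IsSelfAdjoint.conjugate' (ContinuousLinearMap.isSelfAdjoint_iff_isSymmetric.mpr hS)
      ((B⁻¹ : (H →L[ℂ] H)ˣ) : H →L[ℂ] H))
    rw [hBinv.star_eq] at this
    exact ContinuousLinearMap.isSelfAdjoint_iff_isSymmetric.mp this
  · exact (hSc.clm_comp ((B⁻¹ : (H →L[ℂ] H)ˣ) : H →L[ℂ] H)).comp_clm _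
  · rw [hB, CFC.sqrt_mul_sqrt_self A hA0]
  · simp [mul_assoc]

/-- The Fredholm alternative for the pencil `A - k S`. -/
theorem isUnit_pencil {A S : H →L[ℂ] H} (hA : A.IsPositive) (hAu : IsUnit A)
    (hS : S.IsSymmetric) (hSc : IsCompactOperator S) {k : ℂ} (hk : k ∉ pencilEigenvalues A S) :
    IsUnit (A - k • S) := by
  by_cases hk0 : k = 0
  · simpa [hk0] using hAu
  obtain ⟨B, T, -, hTc, hAB, hSB⟩ := exists_symmetrization hA hAu hS hSc
  rw [mem_pencilEigenvalues_iff_hasEigenvalue_inv B hAB hSB hk0] at hk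
  have h1 := (hTc.hasEigenvalue_or_mem_resolventSet (inv_ne_zero hk0)).resolve_left hk
  rw [spectrum.mem_resolventSet_iff] at h1
  have h2 : A - k • S = B * (k • (algebraMap ℂ (H →L[ℂ] H) k⁻¹ - T)) * B := by
    rw [hAB, hSB, smul_sub, Algebra.algebraMap_eq_smul_one, smul_smul, mul_inv_cancel₀ hk0,
      one_smul, mul_sub, mul_one, sub_mul, mul_smul_comm, smul_mul_assoc]
  rw [h2]
  have h3 : IsUnit (k • (algebraMap ℂ (H →L[ℂ] H) k⁻¹ - T)) := by
    simpa using h1.smul (Units.mk0 k hk0)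
  exact (B.isUnit.mul h3).mul B.isUnit

theorem exists_seq_pencilEigenvalues {A S : H →L[ℂ] H} (hH : ¬ FiniteDimensional ℂ H)
    (hA : A.IsPositive) {c : ℝ} (hc : 0 < c) (hAc : ∀ u, c * ‖u‖ ^ 2 ≤ (inner ℂ (A u) u).re)
    (hAu : IsUnit A)
    (hS : S.IsPositive) (hSc : IsCompactOperator S) (hSinj : Function.Injective S) :
    ∃ ev : ℕ → ℝ, (∀ i, 0 < ev i) ∧ Tendsto ev atTop atTop ∧
      pencilEigenvalues A S = Set.range (fun i => (ev i : ℂ)) := by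
  obtain ⟨B, T, hTs, hTc, hAB, hSB⟩ := exists_symmetrization hA hAu hS.isSymmetric hSc
  have hBinj : Function.Injective (B : H →L[ℂ] H) := by
    intro x y hxy
    have := congrArg (↑B⁻¹ : H →L[ℂ] H) hxy
    simpa [← mul_apply_eq_comp] using this
  have hTinj : Function.Injective T := by
    intro x y hxy
    have h2 : ∀ u, (B : H →L[ℂ] H) ((↑B⁻¹ : H →L[ℂ] H) u) = u := fun u => by
      rw [← mul_apply_eq_comp]; simp
    have : S ((↑B⁻¹ : H →L[ℂ] H) x) = S ((↑B⁻¹ : H →L[ℂ] H) y) := by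
      rw [hSB]; simp only [mul_apply_eq_comp, h2, hxy]
    rw [← h2 x, hSinj this, h2]
  have hpos : ∀ k ∈ pencilEigenvalues A S, ∃ r : ℝ, 0 < r ∧ k = r := fun k hk =>
    pencilEigenvalues_pos hA hc hAc hS hk
  let R : Set ℝ := {r | (r : ℂ) ∈ pencilEigenvalues A S}
  have hRpos : ∀ r ∈ R, 0 < r := by
    intro r hr
    obtain ⟨s, hs, h⟩ := hpos _ hr
    rwa [Complex.ofReal_inj.mp h]
  have hRfin : ∀ M : ℝ, {r ∈ R | r ≤ M}.Finite := by
    intro M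
    have hM : (0 : ℝ) < (|M| + 1)⁻¹ := by positivity
    refine Set.Finite.of_finite_image (f := fun r : ℝ => ((r : ℂ))⁻¹)
      ((hTc.finite_setOf_hasEigenvalue hTs hM).subset ?_) ?_
    · rintro _ ⟨r, ⟨hr, hrM⟩, rfl⟩
      have hr0 := hRpos r hr
      refine ⟨(mem_pencilEigenvalues_iff_hasEigenvalue_inv B hAB hSB
        (Complex.ofReal_ne_zero.mpr hr0.ne')).mp hr, ?_⟩
      rw [norm_inv, Complex.norm_real, Real.norm_of_nonneg hr0.le]
      exact inv_anti₀ hr0 (by linarith [le_abs_self M])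
    · intro r _ s _ h
      exact Complex.ofReal_inj.mp (inv_injective h)
  have hRinf : R.Infinite := by
    intro hfin
    refine hTc.infinite_setOf_hasEigenvalue hTs hTinj hH
      ((hfin.image (fun r : ℝ => ((r : ℂ))⁻¹)).subset ?_)
    intro μ hμ
    have hμ0 : μ ≠ 0 := by
      rintro rfl
      obtain ⟨v, hv⟩ := Module.End.HasEigenvalue.exists_hasEigenvector hμ
      have h1 : T v = (0 : ℂ) • v := hv.apply_eq_smul
      exact hv.2 (hTinj (by simpa using h1))
    have h2 : μ⁻¹ ∈ pencilEigenvalues A S := by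
      rw [mem_pencilEigenvalues_iff_hasEigenvalue_inv B hAB hSB (inv_ne_zero hμ0), inv_inv]
      exact hμ
    obtain ⟨r, -, hr⟩ := hpos _ h2
    refine ⟨r, ?_, ?_⟩
    · change (r : ℂ) ∈ pencilEigenvalues A S; rwa [← hr]
    · change (r : ℂ)⁻¹ = μ; rw [← hr, inv_inv]
  have hRcount : R.Countable := by
    have : R = ⋃ n : ℕ, {r ∈ R | r ≤ n} := by
      ext r
      simp only [Set.mem_iUnion, Set.mem_ofPred_eq]
      constructor
      · intro hr
        obtain ⟨n, hn⟩ := exists_nat_ge r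
        exact ⟨n, hr, hn⟩
      · rintro ⟨_, hr, _⟩; exact hr
    rw [this]
    exact Set.countable_iUnion fun n => (hRfin n).countable
  have := hRinf.to_subtype
  have := hRcount.to_subtype
  obtain ⟨e⟩ := nonempty_equiv_of_countable (α := ℕ) (β := R)
  refine ⟨fun n => e n, fun i => hRpos _ (e i).2, ?_, ?_⟩
  · -- An injective enumeration of a set with finitely many points below each level tends to `+∞`.
    rw [← Nat.cofinite_eq_atTop, tendsto_atTop]
    intro M
    refine Filter.mem_cofinite.mpr ?_
    have := (hRfin M).preimage (f := fun n => (e n : ℝ))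
      (fun i _ j _ h => e.injective (Subtype.ext h))
    refine this.subset fun n hn => ⟨(e n).2, ?_⟩
    simp only [Set.mem_compl_iff, Set.mem_ofPred_eq, not_le] at hn
    exact hn.le
  · ext k
    constructor
    · intro hk
      obtain ⟨r, -, rfl⟩ := hpos k hk
      exact ⟨e.symm ⟨r, hk⟩, by simp⟩
    · rintro ⟨n, rfl⟩
      exact (e n).2

/-- The solution of `(A - z S) u = g` depends analytically on `z`. Nothing is asked of `U z` where
`A - z S` is not invertible, since invertibility is an open condition. -/
theorem analyticAt_of_isUnit_pencil {A S : H →L[ℂ] H} {g : H} {U : ℂ → H} {k : ℂ}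
    (hk : IsUnit (A - k • S))
    (hU : ∀ z, IsUnit (A - z • S) → (A - z • S) (U z) = g) : AnalyticAt ℂ U k := by
  have h1 : AnalyticAt ℂ (fun z : ℂ => A - z • S) k := by fun_prop
  have h2 : AnalyticAt ℂ (fun z : ℂ => Ring.inverse (A - z • S) g) k := by
    obtain ⟨x, hx⟩ := hk
    have h3 : AnalyticAt ℂ (fun z : ℂ => Ring.inverse (A - z • S)) k :=
      AnalyticAt.fun_comp (hx ▸ analyticAt_inverse x) h1
    exact ((ContinuousLinearMap.apply ℂ H g).analyticAt _).fun_comp h3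
  refine h2.congr ?_
  have hopen : ∀ᶠ z in 𝓝 k, IsUnit (A - z • S) :=
    h1.continuousAt.eventually (Units.isOpen.mem_nhds hk)
  filter_upwards [hopen] with z hz
  rw [← hU z hz, ← mul_apply_eq_comp, Ring.inverse_mul_cancel _ hz,
    one_apply_eq_self]

/-- The spectral alternative for a pencil `A - k S` of symmetric operators with `A` coercive and `S`
nonnegative, compact and injective, on an infinite-dimensional Hilbert space. -/
theorem exists_spectral_alternative {A S : H →L[ℂ] H} (hH : ¬ FiniteDimensional ℂ H)
    (hA : A.IsSymmetric) {c : ℝ} (hc : 0 < c) (hAc : ∀ u, c * ‖u‖ ^ 2 ≤ (inner ℂ u (A u)).re)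
    (hS : S.IsSymmetric) (hS0 : ∀ u, 0 ≤ (inner ℂ u (S u)).re) (hSc : IsCompactOperator S)
    (hSinj : Function.Injective S) :
    ∃ ev : ℕ → ℝ, (∀ i, 0 < ev i) ∧ Tendsto ev atTop atTop ∧
      pencilEigenvalues A S = Set.range (fun i => (ev i : ℂ)) ∧
      (∀ k : ℂ, k ∉ Set.range (fun i => (ev i : ℂ)) →
        ∃ C : ℝ, 0 < C ∧ ∀ f : H →L⋆[ℂ] ℂ, ∃ u : H,
          (∀ v, inner ℂ v ((A - k • S) u) = f v) ∧
          (∀ w, (∀ v, inner ℂ v ((A - k • S) w) = f v) → w = u) ∧ ‖u‖ ≤ C * ‖f‖) ∧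
      (∀ (f : H →L⋆[ℂ] ℂ) (U : ℂ → H),
        (∀ k : ℂ, k ∉ Set.range (fun i => (ev i : ℂ)) →
          ∀ v, inner ℂ v ((A - k • S) (U k)) = f v) →
        AnalyticOnNhd ℂ U (Set.range (fun i => (ev i : ℂ)))ᶜ) := by
  have hAc' : ∀ u, c * ‖u‖ ^ 2 ≤ (inner ℂ (A u) u).re := fun u =>
    (hAc u).trans_eq (congrArg Complex.re (hA u u)).symm
  have hApos : A.IsPositive := ⟨hA, fun u => le_trans (by positivity) (hAc' u)⟩
  have hSpos : S.IsPositive :=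
    ⟨hS, fun u => (hS0 u).trans_eq (congrArg Complex.re (hS u u)).symm⟩
  have hAu : IsUnit A := by
    refine A.isUnit_of_forall_le_norm_inner_map (c := ⟨c, hc.le⟩) hc fun u => ?_
    rw [mul_comm]
    exact (hAc' u).trans (Complex.re_le_norm _)
  obtain ⟨ev, hev0, hevt, hev⟩ := exists_seq_pencilEigenvalues hH hApos hc hAc' hAu hSpos hSc hSinj
  have hunit : ∀ k : ℂ, k ∉ Set.range (fun i => (ev i : ℂ)) → IsUnit (A - k • S) := fun k hk =>
    isUnit_pencil hApos hAu hS hSc (hev ▸ hk)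
  have hiff : ∀ {f : H →L⋆[ℂ] ℂ} {g : H}, (∀ v, inner ℂ v g = f v) → ∀ (k : ℂ) (u : H),
      (∀ v, inner ℂ v ((A - k • S) u) = f v) ↔ (A - k • S) u = g := fun hg k u =>
    ⟨fun h => ext_inner_left ℂ fun v => by rw [h, hg], fun h v => by rw [h, hg]⟩
  refine ⟨ev, hev0, hevt, hev, fun k hk => ?_, fun f U hU k hk => ?_⟩
  · obtain ⟨P, hP⟩ := hunit k hk
    have hinv1 : ∀ g, (A - k • S) ((↑P⁻¹ : H →L[ℂ] H) g) = g := fun g => by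
      rw [← hP, ← mul_apply_eq_comp, P.mul_inv, one_apply_eq_self]
    have hinv2 : ∀ u, (↑P⁻¹ : H →L[ℂ] H) ((A - k • S) u) = u := fun u => by
      rw [← hP, ← mul_apply_eq_comp, P.inv_mul, one_apply_eq_self]
    refine ⟨‖(↑P⁻¹ : H →L[ℂ] H)‖ + 1, by positivity, fun f => ?_⟩
    obtain ⟨g, hg, hgf⟩ := exists_inner_eq_antidual f
    refine ⟨(↑P⁻¹ : H →L[ℂ] H) g, (hiff hg k _).mpr (hinv1 g), fun w hw => ?_, ?_⟩
    · rw [← (hiff hg k w).mp hw, hinv2]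
    · refine (ContinuousLinearMap.le_opNorm _ g).trans ?_
      gcongr
      linarith
  · obtain ⟨g, hg, -⟩ := exists_inner_eq_antidual f
    refine analyticAt_of_isUnit_pencil (hunit k hk) fun z hz =>
      (hiff hg z _).mp (hU z fun hz' => ?_)
    -- `A - z S` is not injective at an eigenvalue `z`, so it is not invertible there.
    rw [← hev] at hz'
    obtain ⟨u, hu, hAS⟩ := hz'
    obtain ⟨P, hP⟩ := hz
    apply hu
    have h1 : (A - z • S) u = 0 := by rw [sub_apply, smul_apply, hAS, sub_self]
    have h2 : (↑P⁻¹ : H →L[ℂ] H) ((A - z • S) u) = u := by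
      rw [← hP, ← mul_apply_eq_comp, P.inv_mul, one_apply_eq_self]
    rw [← h2, h1, map_zero]

end Abstract

/-! ### Translation and averaging estimates for smooth functions -/

section CauchySchwarz
variable {α : Type*} [MeasurableSpace α] {μ : Measure α}

/-- The Cauchy-Schwarz inequality against the constant function `1`. -/
theorem sq_lintegral_le {f : α → ENNReal} (hf : AEMeasurable f μ) :
    (∫⁻ x, f x ∂μ) ^ 2 ≤ μ Set.univ * ∫⁻ x, f x ^ 2 ∂μ := by
  have h := ENNReal.lintegral_mul_le_Lp_mul_Lq μ Real.HolderConjugate.two_two hf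
    (aemeasurable_const (b := (1 : ENNReal)))
  simp only [Pi.mul_apply, mul_one, ENNReal.one_rpow, lintegral_const, one_mul] at h
  calc (∫⁻ x, f x ∂μ) ^ 2
      ≤ ((∫⁻ x, f x ^ (2 : ℝ) ∂μ) ^ (1 / 2 : ℝ) * μ Set.univ ^ (1 / 2 : ℝ)) ^ 2 := by gcongr
    _ = μ Set.univ * ∫⁻ x, f x ^ 2 ∂μ := by
      rw [mul_pow, ← ENNReal.rpow_natCast, ← ENNReal.rpow_natCast, ← ENNReal.rpow_mul,
        ← ENNReal.rpow_mul, mul_comm]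
      simp

theorem enorm_integral_sq_le {F : Type*} [NormedAddCommGroup F] [NormedSpace ℝ F] {f : α → F}
    (hf : AEStronglyMeasurable f μ) :
    ‖∫ x, f x ∂μ‖ₑ ^ 2 ≤ μ Set.univ * ∫⁻ x, ‖f x‖ₑ ^ 2 ∂μ :=
  (pow_le_pow_left' (enorm_integral_le_lintegral_enorm f) 2).trans (sq_lintegral_le hf.enorm)

end CauchySchwarz

namespace DirichletHelmholtz

variable {d : ℕ}

theorem enorm_clm_apply_sq_le (L : EuclideanSpace ℝ (Fin d) →L[ℝ] ℂ)
    (z : EuclideanSpace ℝ (Fin d)) :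
    ‖L z‖ₑ ^ 2 ≤ ‖z‖ₑ ^ 2 * ∑ i, ‖L (EuclideanSpace.single i 1)‖ₑ ^ 2 := by
  have hz : L z = ∑ i, (z i : ℝ) • L (EuclideanSpace.single i 1) := by
    conv_lhs => rw [← (EuclideanSpace.basisFun (Fin d) ℝ).sum_repr z]
    simp [map_sum]
  have hr : ‖L z‖ ^ 2 ≤ ‖z‖ ^ 2 * ∑ i, ‖L (EuclideanSpace.single i 1)‖ ^ 2 := by
    have h1 : ‖L z‖ ≤ ∑ i, ‖z i‖ * ‖L (EuclideanSpace.single i 1)‖ := by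
      rw [hz]
      exact (norm_sum_le _ _).trans (Finset.sum_le_sum fun i _ => (norm_smul _ _).le)
    calc ‖L z‖ ^ 2 ≤ (∑ i, ‖z i‖ * ‖L (EuclideanSpace.single i 1)‖) ^ 2 := by gcongr
      _ ≤ _ := by
        rw [EuclideanSpace.norm_sq_eq]
        exact Finset.sum_mul_sq_le_sq_mul_sq _ _ _
  have h2 := ENNReal.ofReal_le_ofReal hr
  rw [ENNReal.ofReal_mul (by positivity), ENNReal.ofReal_sum_of_nonneg (fun i _ => by positivity)]
    at h2
  simpa only [ENNReal.ofReal_pow (norm_nonneg _), ofReal_norm] using h2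

/-- `|∇φ(x)|² = ∑ᵢ |∂ᵢφ(x)|²`, as an extended nonnegative real. -/
noncomputable def energyDensity (φ : EuclideanSpace ℝ (Fin d) → ℂ)
    (x : EuclideanSpace ℝ (Fin d)) : ENNReal :=
  ∑ i, ‖partialDeriv i φ x‖ₑ ^ 2

theorem continuous_partialDeriv {φ : EuclideanSpace ℝ (Fin d) → ℂ} (hφ : ContDiff ℝ 1 φ)
    (i : Fin d) : Continuous (partialDeriv i φ) :=
  (hφ.continuous_fderiv (by simp)).clm_apply continuous_const

theorem measurable_energyDensity {φ : EuclideanSpace ℝ (Fin d) → ℂ} (hφ : ContDiff ℝ 1 φ) :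
    Measurable (energyDensity φ) :=
  Finset.measurable_sum _ fun i _ => (continuous_partialDeriv hφ i).measurable.enorm.pow_const 2

theorem enorm_sub_sq_le {φ : EuclideanSpace ℝ (Fin d) → ℂ} (hφ : ContDiff ℝ 1 φ)
    (x z : EuclideanSpace ℝ (Fin d)) :
    ‖φ (x + z) - φ x‖ₑ ^ 2 ≤
      ‖z‖ₑ ^ 2 * ∫⁻ t in Set.Ioc (0 : ℝ) 1, energyDensity φ (x + t • z) := by
  have hcont : Continuous fun t : ℝ => fderiv ℝ φ (x + t • z) z := by
    have := hφ.continuous_fderiv (by simp)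
    fun_prop
  have hderiv : ∀ t : ℝ, HasDerivAt (fun t : ℝ => φ (x + t • z)) (fderiv ℝ φ (x + t • z) z) t := by
    intro t
    have h1 : HasDerivAt (fun t : ℝ => x + t • z) z t := by
      simpa using ((hasDerivAt_id t).smul_const z).const_add x
    exact ((hφ.differentiable (by simp) _).hasFDerivAt).comp_hasDerivAt t h1
  have hftc := intervalIntegral.integral_eq_sub_of_hasDerivAt (a := 0) (b := 1)
    (fun t _ => hderiv t) (hcont.intervalIntegrable _ _)
  simp only [one_smul, zero_smul, add_zero] at hftc
  rw [← hftc, intervalIntegral.integral_of_le zero_le_one]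
  refine (enorm_integral_sq_le hcont.aestronglyMeasurable).trans ?_
  simp only [MeasurableSet.univ, Measure.restrict_apply, Set.univ_inter, Real.volume_Ioc, sub_zero,
    ENNReal.ofReal_one, one_mul]
  rw [← lintegral_const_mul']
  · exact lintegral_mono fun t => enorm_clm_apply_sq_le _ _
  · simp

/-- The translation estimate: the `L²` modulus of continuity is controlled by the gradient. -/
theorem lintegral_enorm_translate_sub_sq_le {φ : EuclideanSpace ℝ (Fin d) → ℂ}
    (hφ : ContDiff ℝ 1 φ) (z : EuclideanSpace ℝ (Fin d)) :
    ∫⁻ x, ‖φ (x + z) - φ x‖ₑ ^ 2 ≤ ‖z‖ₑ ^ 2 * ∫⁻ x, energyDensity φ x := by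
  have hm := measurable_energyDensity hφ
  calc ∫⁻ x, ‖φ (x + z) - φ x‖ₑ ^ 2
      ≤ ∫⁻ x, ‖z‖ₑ ^ 2 * ∫⁻ t in Set.Ioc (0 : ℝ) 1, energyDensity φ (x + t • z) :=
        lintegral_mono fun x => enorm_sub_sq_le hφ x z
    _ = ‖z‖ₑ ^ 2 * ∫⁻ t in Set.Ioc (0 : ℝ) 1, ∫⁻ x, energyDensity φ (x + t • z) := by
        rw [lintegral_const_mul' _ _ (by simp), lintegral_lintegral_swap]
        exact (hm.comp (by fun_prop)).aemeasurable
    _ = ‖z‖ₑ ^ 2 * ∫⁻ x, energyDensity φ x := by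
        simp [lintegral_add_right_eq_self (energyDensity φ)]

/-- The **Poincaré inequality**. Where `φ x ≠ 0` one has `|φ x| = |φ (x + z) - φ x|`, so the
translation estimate bounds `φ` itself. -/
theorem lintegral_enorm_sq_le_of_disjoint_translate {φ : EuclideanSpace ℝ (Fin d) → ℂ}
    (hφ : ContDiff ℝ 1 φ) {z : EuclideanSpace ℝ (Fin d)}
    (hz : ∀ x, φ x ≠ 0 → φ (x + z) = 0) :
    ∫⁻ x, ‖φ x‖ₑ ^ 2 ≤ ‖z‖ₑ ^ 2 * ∫⁻ x, energyDensity φ x := by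
  refine le_trans (lintegral_mono fun x => ?_) (lintegral_enorm_translate_sub_sq_le hφ z)
  by_cases hx : φ x = 0
  · simp [hx]
  · simp [hz x hx]

/-- The half-open cube of side `δ` with index `k` of the grid `δ ℤ^d`. -/
def gridCube (δ : ℝ) (k : Fin d → ℤ) : Set (EuclideanSpace ℝ (Fin d)) :=
  {x | ∀ i, ⌊x i / δ⌋ = k i}

theorem measurableSet_gridCube (δ : ℝ) (k : Fin d → ℤ) : MeasurableSet (gridCube δ k) := by
  have : gridCube δ k = ⋂ i, (fun x : EuclideanSpace ℝ (Fin d) => ⌊x i / δ⌋) ⁻¹' {k i} := by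
    ext x; simp [gridCube]
  rw [this]
  refine MeasurableSet.iInter fun i => ?_
  have : Measurable fun x : EuclideanSpace ℝ (Fin d) => ⌊x i / δ⌋ :=
    Int.measurable_floor.comp (by fun_prop)
  exact this (measurableSet_singleton _)

theorem volume_gridCube {δ : ℝ} (hδ : 0 < δ) (k : Fin d → ℤ) :
    volume (gridCube δ k) = ENNReal.ofReal δ ^ d := by
  have h1 : gridCube δ k = (WithLp.ofLp : EuclideanSpace ℝ (Fin d) → Fin d → ℝ) ⁻¹'
      Set.univ.pi fun i => Set.Ico (k i * δ) ((k i + 1) * δ) := by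
    ext x
    simp only [gridCube, Set.mem_ofPred_eq, Set.mem_preimage, Set.mem_univ_pi, Set.mem_Ico]
    refine forall_congr' fun i => ?_
    rw [Int.floor_eq_iff, le_div_iff₀ hδ, div_lt_iff₀ hδ]
  rw [h1, (PiLp.volume_preserving_ofLp (Fin d)).measure_preimage
    (MeasurableSet.univ_pi fun i => measurableSet_Ico).nullMeasurableSet, volume_pi_pi]
  simp [add_mul]

theorem norm_sub_le_of_mem_gridCube {δ : ℝ} (hδ : 0 < δ) {k : Fin d → ℤ}
    {x y : EuclideanSpace ℝ (Fin d)} (hx : x ∈ gridCube δ k) (hy : y ∈ gridCube δ k) :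
    ‖y - x‖ ≤ √d * δ := by
  have h : ‖y - x‖ ^ 2 ≤ d * δ ^ 2 := by
    rw [EuclideanSpace.norm_sq_eq]
    calc ∑ i, ‖(y - x) i‖ ^ 2 ≤ ∑ _i : Fin d, δ ^ 2 := by
          refine Finset.sum_le_sum fun i _ => ?_
          have h1 := Int.abs_sub_lt_one_of_floor_eq_floor ((hy i).trans (hx i).symm)
          rw [← sub_div, abs_div, abs_of_pos hδ, div_lt_one hδ] at h1
          have : ‖(y - x) i‖ ≤ δ := h1.le
          gcongr
      _ = d * δ ^ 2 := by simp
  refine le_of_sq_le_sq ?_ (by positivity)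
  rwa [mul_pow, Real.sq_sqrt (Nat.cast_nonneg d)]

/-- The distance from `φ x` to the average of `φ` over the grid cube containing `x`, in terms of
translations: all points of the cube are within `√d δ` of `x`. -/
theorem enorm_sub_average_sq_le {φ : EuclideanSpace ℝ (Fin d) → ℂ} (hφ : Continuous φ)
    {δ : ℝ} (hδ : 0 < δ) {k : Fin d → ℤ} (hint : IntegrableOn φ (gridCube δ k))
    {x : EuclideanSpace ℝ (Fin d)} (hx : x ∈ gridCube δ k) :
    ‖φ x - ((δ ^ d)⁻¹ : ℝ) • ∫ y in gridCube δ k, φ y‖ₑ ^ 2 ≤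
      (ENNReal.ofReal δ ^ d)⁻¹ *
        ∫⁻ z in Metric.closedBall 0 (√d * δ), ‖φ (x + z) - φ x‖ₑ ^ 2 := by
  have hδd : 0 < δ ^ d := pow_pos hδ d
  have hvol := volume_gridCube hδ k
  have hvr : volume.real (gridCube δ k) = δ ^ d := by
    rw [measureReal_def, hvol, ENNReal.toReal_pow, ENNReal.toReal_ofReal hδ.le]
  have hfin : volume (gridCube δ k) ≠ ⊤ := by
    rw [hvol]; exact ENNReal.pow_ne_top ENNReal.ofReal_ne_top
  have h1 : φ x - ((δ ^ d)⁻¹ : ℝ) • ∫ y in gridCube δ k, φ y =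
      -(((δ ^ d)⁻¹ : ℝ) • ∫ y in gridCube δ k, (φ y - φ x)) := by
    rw [integral_sub hint (integrableOn_const hfin), setIntegral_const, hvr, smul_sub, smul_smul,
      inv_mul_cancel₀ hδd.ne', one_smul]
    ring
  have hofr : ENNReal.ofReal (δ ^ d) = ENNReal.ofReal δ ^ d := ENNReal.ofReal_pow hδ.le d
  have hne0 : ENNReal.ofReal δ ^ d ≠ 0 := pow_ne_zero _ (by simpa using hδ)
  have hnet : ENNReal.ofReal δ ^ d ≠ ⊤ := ENNReal.pow_ne_top ENNReal.ofReal_ne_top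
  rw [h1, enorm_neg, enorm_smul, mul_pow]
  have h2 : ‖((δ ^ d)⁻¹ : ℝ)‖ₑ = (ENNReal.ofReal δ ^ d)⁻¹ := by
    rw [Real.enorm_of_nonneg (by positivity), ENNReal.ofReal_inv_of_pos hδd, hofr]
  have h3 : ‖∫ y in gridCube δ k, (φ y - φ x)‖ₑ ^ 2 ≤
      ENNReal.ofReal δ ^ d * ∫⁻ y in gridCube δ k, ‖φ y - φ x‖ₑ ^ 2 := by
    have := enorm_integral_sq_le (μ := volume.restrict (gridCube δ k))
      (f := fun y => φ y - φ x) (by fun_prop)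
    simpa [hvol] using this
  have h4 : ∫⁻ y in gridCube δ k, ‖φ y - φ x‖ₑ ^ 2 ≤
      ∫⁻ z in Metric.closedBall 0 (√d * δ), ‖φ (x + z) - φ x‖ₑ ^ 2 := by
    rw [← lintegral_indicator (measurableSet_gridCube δ k),
      ← lintegral_indicator Metric.isClosed_closedBall.measurableSet,
      ← lintegral_add_left_eq_self _ x]
    refine lintegral_mono fun z => ?_
    by_cases hz : x + z ∈ gridCube δ k
    · have : z ∈ Metric.closedBall (0 : EuclideanSpace ℝ (Fin d)) (√d * δ) := by
        have := norm_sub_le_of_mem_gridCube hδ hx hz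
        simpa using this
      simp [hz, this]
    · simp [hz]
  calc _ ≤ (ENNReal.ofReal δ ^ d)⁻¹ ^ 2 * (ENNReal.ofReal δ ^ d *
        ∫⁻ z in Metric.closedBall 0 (√d * δ), ‖φ (x + z) - φ x‖ₑ ^ 2) := by
        rw [h2]; gcongr; exact h3.trans (by gcongr)
    _ = _ := by
        rw [sq, mul_assoc, ← mul_assoc (ENNReal.ofReal δ ^ d)⁻¹ (ENNReal.ofReal δ ^ d),
          ENNReal.inv_mul_cancel hne0 hnet, one_mul]

/-- The squared constant in the `L²` estimate by `C δ ‖∇φ‖` for averaging over cubes of side `δ`.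
The factor `d` and the power `√d ^ d` come from the radius `√d δ` of the translations. -/
noncomputable def gridConst (d : ℕ) : ENNReal :=
  ENNReal.ofReal (√d ^ d) * volume (Metric.ball (0 : EuclideanSpace ℝ (Fin d)) 1) * d

theorem gridConst_ne_top (d : ℕ) : gridConst d ≠ ⊤ :=
  ENNReal.mul_ne_top (ENNReal.mul_ne_top ENNReal.ofReal_ne_top measure_ball_lt_top.ne) (by simp)

theorem lintegral_lintegral_translate_le {φ : EuclideanSpace ℝ (Fin d) → ℂ} (hφ : ContDiff ℝ 1 φ)
    {δ : ℝ} (hδ : 0 < δ) :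
    ∫⁻ x, (ENNReal.ofReal δ ^ d)⁻¹ *
        ∫⁻ z in Metric.closedBall 0 (√d * δ), ‖φ (x + z) - φ x‖ₑ ^ 2 ≤
      gridConst d * ENNReal.ofReal δ ^ 2 * ∫⁻ x, energyDensity φ x := by
  have hne0 : ENNReal.ofReal δ ^ d ≠ 0 := pow_ne_zero _ (by simpa using hδ)
  have hnet : ENNReal.ofReal δ ^ d ≠ ⊤ := ENNReal.pow_ne_top ENNReal.ofReal_ne_top
  have hc := hφ.continuous
  have hswap : ∫⁻ x, ∫⁻ z in Metric.closedBall 0 (√d * δ), ‖φ (x + z) - φ x‖ₑ ^ 2 =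
      ∫⁻ z in Metric.closedBall 0 (√d * δ), ∫⁻ x, ‖φ (x + z) - φ x‖ₑ ^ 2 := by
    rw [lintegral_lintegral_swap]
    have : Continuous fun p : EuclideanSpace ℝ (Fin d) × EuclideanSpace ℝ (Fin d) =>
        φ (p.1 + p.2) - φ p.1 := by fun_prop
    exact (this.measurable.enorm.pow_const 2).aemeasurable
  have hball : ∫⁻ z in Metric.closedBall (0 : EuclideanSpace ℝ (Fin d)) (√d * δ),
      ∫⁻ x, ‖φ (x + z) - φ x‖ₑ ^ 2 ≤
      ∫⁻ _ in Metric.closedBall (0 : EuclideanSpace ℝ (Fin d)) (√d * δ),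
        ENNReal.ofReal (√d * δ) ^ 2 * ∫⁻ x, energyDensity φ x := by
    refine setLIntegral_mono' Metric.isClosed_closedBall.measurableSet fun z hz => ?_
    refine (lintegral_enorm_translate_sub_sq_le hφ z).trans ?_
    gcongr
    rw [← ofReal_norm]
    exact ENNReal.ofReal_le_ofReal (by simpa using hz)
  rw [lintegral_const_mul' _ _ (ENNReal.inv_ne_top.mpr hne0), hswap]
  refine (mul_le_mul_right hball _).trans (le_of_eq ?_)
  rw [lintegral_const, Measure.restrict_apply_univ,
    Measure.addHaar_closedBall _ _ (by positivity), finrank_euclideanSpace_fin, mul_pow,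
    ENNReal.ofReal_mul (by positivity), mul_pow, ENNReal.ofReal_mul (by positivity),
    ENNReal.ofReal_pow hδ.le, ← ENNReal.ofReal_pow (Real.sqrt_nonneg _),
    Real.sq_sqrt (Nat.cast_nonneg d),
    ENNReal.ofReal_natCast, gridConst]
  calc _ = ((ENNReal.ofReal δ ^ d)⁻¹ * ENNReal.ofReal δ ^ d) * (ENNReal.ofReal (√d ^ d) *
        volume (Metric.ball (0 : EuclideanSpace ℝ (Fin d)) 1) * d * ENNReal.ofReal δ ^ 2 *
        ∫⁻ x, energyDensity φ x) := by ring
    _ = _ := by rw [ENNReal.inv_mul_cancel hne0 hnet, one_mul]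

end DirichletHelmholtz

/-! ### `H¹(Ω)` and `H¹₀(Ω)`: gradients, the Poincaré inequality, Rellich's theorem -/

theorem MeasureTheory.Lp.enorm_sq_eq_lintegral {α F : Type*} [MeasurableSpace α] {μ : Measure α}
    [NormedAddCommGroup F] (f : Lp F 2 μ) : ‖f‖ₑ ^ 2 = ∫⁻ x, ‖f x‖ₑ ^ 2 ∂μ := by
  rw [Lp.enorm_def, eLpNorm_eq_lintegral_rpow_enorm_toReal (by simp) (by simp),
    ← ENNReal.rpow_natCast, ← ENNReal.rpow_mul]
  simp

namespace DirichletHelmholtz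

variable {d : ℕ} {Ω : Set (EuclideanSpace ℝ (Fin d))}

-- These shortcuts make instance search find the same normed structures on the nested subspaces
-- along every path; otherwise some of its solutions agree only after heavy unfolding.
noncomputable scoped instance : NormedAddCommGroup (H1 Ω) := Submodule.normedAddCommGroup _
noncomputable scoped instance : InnerProductSpace ℂ (H1 Ω) := Submodule.innerProductSpace _
noncomputable scoped instance : NormedAddCommGroup (H10 Ω) := Submodule.normedAddCommGroup _
noncomputable scoped instance : InnerProductSpace ℂ (H10 Ω) := Submodule.innerProductSpace _
noncomputable scoped instance : NormedSpace ℂ (H1 Ω) := Submodule.normedSpace _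
noncomputable scoped instance : NormedSpace ℂ (H10 Ω) := Submodule.normedSpace _

namespace IsTestFunction
variable {φ ψ : EuclideanSpace ℝ (Fin d) → ℂ}

theorem contDiff_one (h : IsTestFunction Ω φ) : ContDiff ℝ 1 φ := h.contDiff.of_le (by simp)

theorem eq_zero_of_notMem (h : IsTestFunction Ω φ) {x : EuclideanSpace ℝ (Fin d)} (hx : x ∉ Ω) :
    φ x = 0 :=
  image_eq_zero_of_notMem_tsupport fun hx' => hx (h.tsupport_subset hx')

theorem partialDeriv_eq_zero_of_notMem (h : IsTestFunction Ω φ) (i : Fin d)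
    {x : EuclideanSpace ℝ (Fin d)} (hx : x ∉ Ω) : partialDeriv i φ x = 0 := by
  have h1 : fderiv ℝ φ x = 0 := image_eq_zero_of_notMem_tsupport fun hx' =>
    hx (h.tsupport_subset (tsupport_fderiv_subset ℝ hx'))
  simp [partialDeriv, h1]

theorem continuous_partialDeriv (h : IsTestFunction Ω φ) (i : Fin d) :
    Continuous (partialDeriv i φ) :=
  DirichletHelmholtz.continuous_partialDeriv h.contDiff_one i

theorem setIntegral_mul_partialDeriv (hφ : IsTestFunction Ω φ) (hψ : IsTestFunction Ω ψ)
    (i : Fin d) :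
    ∫ x in Ω, φ x * partialDeriv i ψ x = - ∫ x in Ω, partialDeriv i φ x * ψ x := by
  rw [setIntegral_eq_integral_of_forall_compl_eq_zero
      (fun x hx => by rw [hφ.eq_zero_of_notMem hx, zero_mul]),
    setIntegral_eq_integral_of_forall_compl_eq_zero
      (fun x hx => by rw [hψ.eq_zero_of_notMem hx, mul_zero])]
  refine integral_mul_fderiv_eq_neg_fderiv_mul_of_integrable ?_ ?_ ?_
    (fun x _ => hφ.contDiff_one.differentiable (by simp) x)
    (fun x _ => hψ.contDiff_one.differentiable (by simp) x)
  · exact ((hφ.continuous_partialDeriv i).mul hψ.contDiff.continuous)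
      |>.integrable_of_hasCompactSupport
      hψ.hasCompactSupport.mul_left
  · exact (hφ.contDiff.continuous.mul (hψ.continuous_partialDeriv i))
      |>.integrable_of_hasCompactSupport
      hφ.hasCompactSupport.mul_right
  · exact (hφ.contDiff.continuous.mul hψ.contDiff.continuous).integrable_of_hasCompactSupport
      hψ.hasCompactSupport.mul_left

end IsTestFunction

/-- The fundamental lemma of the calculus of variations in `L²(Ω)`. -/
theorem ae_eq_zero_of_forall_setIntegral_mul_eq_zero (hΩ : IsOpen Ω)
    {f : EuclideanSpace ℝ (Fin d) → ℂ} (hf : MemLp f 2 (volume.restrict Ω))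
    (h : ∀ ψ, IsTestFunction Ω ψ → ∫ x in Ω, f x * ψ x = 0) : f =ᵐ[volume.restrict Ω] 0 := by
  have hloc : LocallyIntegrableOn f Ω volume :=
    locallyIntegrableOn_of_locallyIntegrable_restrict (hf.locallyIntegrable (by norm_num))
  have := hΩ.ae_eq_zero_of_integral_contDiff_smul_eq_zero hloc (fun g hg hgc hgs => by
    have htest : IsTestFunction Ω (fun x => (g x : ℂ)) :=
      ⟨Complex.ofRealCLM.contDiff.comp hg, hgc.comp_left (g := fun r : ℝ => (r : ℂ)) (by simp),
        (closure_mono (Function.support_comp_subset (g := fun r : ℝ => (r : ℂ)) (by simp) g)).trans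
          hgs⟩
    rw [← h _ htest, setIntegral_eq_integral_of_forall_compl_eq_zero
      (fun x hx => by rw [htest.eq_zero_of_notMem hx, mul_zero])]
    simp [mul_comm])
  rw [Filter.EventuallyEq, ae_restrict_iff' hΩ.measurableSet]
  exact this

/-- The weak gradient of a test function is its classical gradient; in particular weak gradients are
unique. -/
theorem IsWeakGradient.coord_ae_eq (hΩ : IsOpen Ω) {u : L2 Ω} {g : L2Vec Ω}
    (h : IsWeakGradient Ω u g) {φ : EuclideanSpace ℝ (Fin d) → ℂ} (hφ : IsTestFunction Ω φ)
    (hu : u =ᵐ[volume.restrict Ω] φ) (i : Fin d) :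
    (fun x => g x i) =ᵐ[volume.restrict Ω] partialDeriv i φ := by
  have hgi : MemLp (fun x => g x i) 2 (volume.restrict Ω) :=
    (EuclideanSpace.proj (𝕜 := ℂ) i).comp_memLp' (Lp.memLp g)
  have := ae_eq_zero_of_forall_setIntegral_mul_eq_zero hΩ (hgi.sub (hφ.memLp_partialDeriv i))
    (fun ψ hψ => by
      have h1 : ∫ x in Ω, u x * partialDeriv i ψ x = ∫ x in Ω, φ x * partialDeriv i ψ x :=
        integral_congr_ae (by filter_upwards [hu] with x hx; rw [hx])
      have h2 := h ψ hψ i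
      rw [h1, hφ.setIntegral_mul_partialDeriv hψ, neg_inj] at h2
      have h3 : Integrable (fun x => partialDeriv i φ x * ψ x) (volume.restrict Ω) :=
        (hφ.memLp_partialDeriv i).integrable_mul hψ.memLp
      simp only [Pi.sub_apply, sub_mul]
      rw [integral_sub (integrable_coord_mul g hψ i) h3, h2, sub_self])
  filter_upwards [this] with x hx
  exact sub_eq_zero.mp hx

theorem isTestFunction_zero : IsTestFunction Ω (0 : EuclideanSpace ℝ (Fin d) → ℂ) :=
  ⟨contDiff_const, HasCompactSupport.zero, by simp [tsupport]⟩

/-- `u ↦ u`, as a map `H¹(Ω) → L²(Ω)`. -/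
noncomputable def fnL (Ω : Set (EuclideanSpace ℝ (Fin d))) : H1 Ω →L[ℂ] L2 Ω :=
  (WithLp.fstL 2 ℂ (L2 Ω) (L2Vec Ω)).comp (H1 Ω).subtypeL

/-- `u ↦ ∇u`, as a map `H¹(Ω) → L²(Ω; ℂ^d)`. -/
noncomputable def gradL (Ω : Set (EuclideanSpace ℝ (Fin d))) : H1 Ω →L[ℂ] L2Vec Ω :=
  (WithLp.sndL 2 ℂ (L2 Ω) (L2Vec Ω)).comp (H1 Ω).subtypeL

/-- The `i`-th coordinate of a vector field. -/
noncomputable def coordL (Ω : Set (EuclideanSpace ℝ (Fin d))) (i : Fin d) : L2Vec Ω →L[ℂ] L2 Ω :=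
  (EuclideanSpace.proj (𝕜 := ℂ) i).compLpL 2 (volume.restrict Ω)

theorem coordL_ae_eq (i : Fin d) (g : L2Vec Ω) :
    coordL Ω i g =ᵐ[volume.restrict Ω] fun x => g x i :=
  (EuclideanSpace.proj (𝕜 := ℂ) i).coeFn_compLpL g

theorem norm_sq_H1 (w : H1 Ω) : ‖w‖ ^ 2 = ‖fnL Ω w‖ ^ 2 + ‖gradL Ω w‖ ^ 2 :=
  WithLp.prod_norm_sq_eq_of_L2 (w : WithLp 2 (L2 Ω × L2Vec Ω))

/-- The weak gradient is determined by the function, so that `H¹(Ω)` embeds into `L²(Ω)`. -/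
theorem gradL_eq_zero (hΩ : IsOpen Ω) {w : H1 Ω} (hw : fnL Ω w = 0) : gradL Ω w = 0 := by
  have h0 : (w.1.fst : L2 Ω) =ᵐ[volume.restrict Ω] (0 : EuclideanSpace ℝ (Fin d) → ℂ) := by
    change (fnL Ω w : L2 Ω) =ᵐ[volume.restrict Ω] _
    rw [hw]; exact Lp.coeFn_zero _ _ _
  have h1 := fun i => IsWeakGradient.coord_ae_eq hΩ w.2 isTestFunction_zero h0 i
  rw [Lp.eq_zero_iff_ae_eq_zero]
  filter_upwards [ae_all_iff.mpr h1] with x hx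
  ext i
  rw [show (gradL Ω w x) i = _ from hx i]
  simp [partialDeriv]

theorem fnL_injective (hΩ : IsOpen Ω) : Function.Injective (fnL Ω) := by
  rw [injective_iff_map_eq_zero]
  intro w hw
  have := norm_sq_H1 w
  rw [hw, gradL_eq_zero hΩ hw] at this
  simpa using this

theorem continuous_setIntegral_mul {g : EuclideanSpace ℝ (Fin d) → ℂ}
    (hg : MemLp g 2 (volume.restrict Ω)) : Continuous fun u : L2 Ω => ∫ x in Ω, u x * g x := by
  have : (fun u : L2 Ω => ∫ x in Ω, u x * g x) = fun u : L2 Ω =>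
      (ContinuousLinearMap.mul ℂ ℂ).lpPairing (volume.restrict Ω) 2 2 u (hg.toLp g) := by
    ext u
    rw [ContinuousLinearMap.lpPairing_eq_integral]
    refine integral_congr_ae ?_
    filter_upwards [hg.coeFn_toLp] with x hx
    rw [hx]; rfl
  rw [this]
  fun_prop

theorem isClosed_H1 (Ω : Set (EuclideanSpace ℝ (Fin d))) :
    IsClosed (H1 Ω : Set (WithLp 2 (L2 Ω × L2Vec Ω))) := by
  have : (H1 Ω : Set (WithLp 2 (L2 Ω × L2Vec Ω))) =
      ⋂ (φ : EuclideanSpace ℝ (Fin d) → ℂ) (_ : IsTestFunction Ω φ) (i : Fin d),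
        {p | ∫ x in Ω, p.fst x * partialDeriv i φ x = - ∫ x in Ω, p.snd x i * φ x} := by
    ext p
    simp only [Set.mem_iInter]
    rfl
  rw [this]
  refine isClosed_iInter fun φ => isClosed_iInter fun hφ => isClosed_iInter fun i =>
    isClosed_eq ?_ ?_
  · exact (continuous_setIntegral_mul (hφ.memLp_partialDeriv i)).comp
      (WithLp.fstL 2 ℂ (L2 Ω) (L2Vec Ω)).continuous
  · refine Continuous.neg ?_
    have h1 := (continuous_setIntegral_mul hφ.memLp).comp
      ((coordL Ω i).comp (WithLp.sndL 2 ℂ (L2 Ω) (L2Vec Ω))).continuous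
    convert h1 using 2 with p
    refine integral_congr_ae ?_
    filter_upwards [coordL_ae_eq i p.snd] with x hx
    exact congrArg (· * φ x) hx.symm

instance : CompleteSpace (H1 Ω) := (isClosed_H1 Ω).completeSpace_coe

instance : CompleteSpace (H10 Ω) :=
  (Submodule.isClosed_topologicalClosure (testSubspace Ω)).completeSpace_coe

/-- An estimate between continuous functions extends from test functions to `H¹₀(Ω)`. -/
theorem le_of_forall_testSubspace {F G : H1 Ω → ℝ} (hF : Continuous F) (hG : Continuous G)
    (h : ∀ w ∈ testSubspace Ω, F w ≤ G w) {w : H1 Ω} (hw : w ∈ H10 Ω) : F w ≤ G w :=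
  closure_minimal (t := {w | F w ≤ G w}) h (isClosed_le hF hG) hw

theorem lintegral_energyDensity_eq (hΩ : IsOpen Ω) {w : H1 Ω}
    {φ : EuclideanSpace ℝ (Fin d) → ℂ} (hφ : IsTestFunction Ω φ)
    (hw : w.1.fst =ᵐ[volume.restrict Ω] φ) :
    ∫⁻ x, energyDensity φ x = ‖gradL Ω w‖ₑ ^ 2 := by
  have h1 := fun i => IsWeakGradient.coord_ae_eq hΩ w.2 hφ hw i
  rw [Lp.enorm_sq_eq_lintegral, ← setLIntegral_eq_of_support_subset (s := Ω)]
  · refine lintegral_congr_ae ?_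
    filter_upwards [ae_all_iff.mpr h1] with x hx
    have h2 : ‖gradL Ω w x‖ ^ 2 = ∑ i, ‖partialDeriv i φ x‖ ^ 2 := by
      rw [EuclideanSpace.norm_sq_eq]
      exact Finset.sum_congr rfl fun i _ => by rw [← hx i]; rfl
    rw [energyDensity, ← ofReal_norm, ← ENNReal.ofReal_pow (norm_nonneg _), h2,
      ENNReal.ofReal_sum_of_nonneg fun i _ => by positivity]
    simp only [ENNReal.ofReal_pow (norm_nonneg _), ofReal_norm]
  · intro x hx
    by_contra hxΩ
    apply hx
    simp [energyDensity, hφ.partialDeriv_eq_zero_of_notMem _ hxΩ]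

theorem norm_sq_le_of_enorm_sq_le {E F : Type*} [NormedAddCommGroup E] [NormedAddCommGroup F]
    {x : E} {y : F} {c : ENNReal} (hc : c ≠ ⊤) (h : ‖x‖ₑ ^ 2 ≤ c * ‖y‖ₑ ^ 2) :
    ‖x‖ ^ 2 ≤ c.toReal * ‖y‖ ^ 2 := by
  have := ENNReal.toReal_mono (ENNReal.mul_ne_top hc (by simp)) h
  simpa using this

/-- **Poincaré inequality** in `H¹₀(Ω)`. -/
theorem exists_poincare (hd : 1 ≤ d) (hΩ : IsOpen Ω) (hb : Bornology.IsBounded Ω) :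
    ∃ C : ℝ, 0 ≤ C ∧ ∀ w ∈ H10 Ω, ‖fnL Ω w‖ ^ 2 ≤ C * ‖gradL Ω w‖ ^ 2 := by
  obtain ⟨R, hR⟩ := hb.subset_closedBall 0
  let z : EuclideanSpace ℝ (Fin d) := EuclideanSpace.single ⟨0, hd⟩ (2 * |R| + 1)
  have hz : ‖z‖ = 2 * |R| + 1 := by
    simp only [z, PiLp.norm_single, Real.norm_eq_abs]
    exact abs_of_pos (by positivity)
  refine ⟨(‖z‖ₑ ^ 2).toReal, by positivity, fun w hw => le_of_forall_testSubspace
    (F := fun w => ‖fnL Ω w‖ ^ 2) (G := fun w => (‖z‖ₑ ^ 2).toReal * ‖gradL Ω w‖ ^ 2)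
    (by fun_prop) (by fun_prop) ?_ hw⟩
  rintro w ⟨φ, hφ, hwφ⟩
  refine norm_sq_le_of_enorm_sq_le (by simp) ?_
  rw [← lintegral_energyDensity_eq hΩ hφ hwφ]
  refine le_trans ?_ (lintegral_enorm_sq_le_of_disjoint_translate hφ.contDiff_one (z := z) ?_)
  · rw [Lp.enorm_sq_eq_lintegral]
    refine (le_of_eq (lintegral_congr_ae ?_)).trans (setLIntegral_le_lintegral Ω _)
    filter_upwards [hwφ] with x hx
    rw [show fnL Ω w x = φ x from hx]
  · intro x hx
    refine hφ.eq_zero_of_notMem fun hxz => ?_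
    have h1 : x ∈ Ω := by
      by_contra h; exact hx (hφ.eq_zero_of_notMem h)
    have h2 := mem_closedBall_zero_iff.mp (hR h1)
    have h3 := mem_closedBall_zero_iff.mp (hR hxz)
    have h4 : ‖z‖ ≤ ‖x + z‖ + ‖x‖ := by
      simpa using norm_sub_le (x + z) x
    have := le_abs_self R
    linarith

/-- The finitely many grid cubes of side `δ` that may meet the closed ball of radius `R`. -/
noncomputable def gridIndices (d : ℕ) (δ R : ℝ) : Finset (Fin d → ℤ) :=
  Fintype.piFinset fun _ => Finset.Icc ⌊-R / δ⌋ ⌊R / δ⌋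

/-- The indicator function of a grid cube, as an element of `L²(Ω)`. -/
noncomputable def cubeIndicator (Ω : Set (EuclideanSpace ℝ (Fin d))) (δ : ℝ) (k : Fin d → ℤ)
    (hfin : volume.restrict Ω (gridCube δ k) ≠ ⊤) : L2 Ω :=
  indicatorConstLp 2 (measurableSet_gridCube δ k) hfin 1

/-- Averaging over grid cubes of side `δ`, as a finite-rank operator on `L²(Ω)` for `Ω` inside
the ball of radius `R`. The cubes that stick out of `Ω` are averaged with the full volume `δ ^ d`,
that is, `u` is extended by zero. -/
noncomputable def cubeAverage (Ω : Set (EuclideanSpace ℝ (Fin d)))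
    [IsFiniteMeasure (volume.restrict Ω)] (δ R : ℝ) : L2 Ω →L[ℂ] L2 Ω :=
  ∑ k ∈ gridIndices d δ R, (((δ ^ d)⁻¹ : ℝ) : ℂ) •
    InnerProductSpace.rankOne ℂ (cubeIndicator Ω δ k (measure_ne_top _ _))
      (cubeIndicator Ω δ k (measure_ne_top _ _))

theorem isCompactOperator_rankOne {E F : Type*} [NormedAddCommGroup E] [InnerProductSpace ℂ E]
    [NormedAddCommGroup F] [InnerProductSpace ℂ F] (x : E) (y : F) :
    IsCompactOperator (InnerProductSpace.rankOne ℂ x y) := by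
  have h : IsCompactOperator (ContinuousLinearMap.toSpanSingleton ℂ x) :=
    isCompactOperator_of_locallyCompactSpace_rng _
  exact h.comp_clm (innerSL ℂ y)

theorem isCompactOperator_cubeAverage [IsFiniteMeasure (volume.restrict Ω)] (δ R : ℝ) :
    IsCompactOperator (cubeAverage Ω δ R) := by
  refine (compactOperator (RingHom.id ℂ) (L2 Ω) (L2 Ω)).sum_mem
    (f := fun k => (((((δ ^ d)⁻¹ : ℝ) : ℂ) •
    InnerProductSpace.rankOne ℂ (cubeIndicator Ω δ k (measure_ne_top _ _))
      (cubeIndicator Ω δ k (measure_ne_top _ _)) : L2 Ω →L[ℂ] L2 Ω))) fun k _ => ?_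
  exact (compactOperator (RingHom.id ℂ) (L2 Ω) (L2 Ω)).smul_mem _ (isCompactOperator_rankOne _ _)

theorem mem_gridIndices {δ R : ℝ} (hδ : 0 < δ) {x : EuclideanSpace ℝ (Fin d)} (hx : ‖x‖ ≤ R) :
    (fun i => ⌊x i / δ⌋) ∈ gridIndices d δ R := by
  simp only [gridIndices, Fintype.mem_piFinset, Finset.mem_Icc]
  intro i
  have h := abs_le.mp ((PiLp.norm_apply_le x i).trans hx)
  exact ⟨Int.floor_le_floor (by gcongr; exact h.1), Int.floor_le_floor (by gcongr; exact h.2)⟩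

theorem cubeAverage_ae_eq [IsFiniteMeasure (volume.restrict Ω)] (hΩ : MeasurableSet Ω)
    {δ R : ℝ} (hδ : 0 < δ) (hR : Ω ⊆ Metric.closedBall 0 R) (u : L2 Ω) :
    ∀ᵐ x ∂volume.restrict Ω, cubeAverage Ω δ R u x =
      ((δ ^ d)⁻¹ : ℝ) • ∫ y in gridCube δ (fun i => ⌊x i / δ⌋), u y ∂volume.restrict Ω := by
  have h1 : ∀ k, ∀ᵐ x ∂volume.restrict Ω, cubeIndicator Ω δ k (measure_ne_top _ _) x =
      (gridCube δ k).indicator (fun _ => (1 : ℂ)) x := fun k => indicatorConstLp_coeFn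
  have h2 : cubeAverage Ω δ R u = ∑ k ∈ gridIndices d δ R,
      ((((δ ^ d)⁻¹ : ℝ) : ℂ) * ∫ y in gridCube δ k, u y ∂volume.restrict Ω) •
        cubeIndicator Ω δ k (measure_ne_top _ _) := by
    rw [cubeAverage, sum_apply]
    refine Finset.sum_congr rfl fun k _ => ?_
    rw [smul_apply, InnerProductSpace.rankOne_apply, cubeIndicator,
      L2.inner_indicatorConstLp_one, smul_smul]
  have h3 : ∀ k, ∀ᵐ x ∂volume.restrict Ω,
      (((((δ ^ d)⁻¹ : ℝ) : ℂ) * ∫ y in gridCube δ k, u y ∂volume.restrict Ω) •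
        cubeIndicator Ω δ k (measure_ne_top _ _) : L2 Ω) x =
      ((((δ ^ d)⁻¹ : ℝ) : ℂ) * ∫ y in gridCube δ k, u y ∂volume.restrict Ω) •
        cubeIndicator Ω δ k (measure_ne_top _ _) x := fun k => Lp.coeFn_smul _ _
  rw [h2]
  filter_upwards [Lp.coeFn_finsetSum (gridIndices d δ R) fun k =>
      ((((δ ^ d)⁻¹ : ℝ) : ℂ) * ∫ y in gridCube δ k, u y ∂volume.restrict Ω) •
        cubeIndicator Ω δ k (measure_ne_top _ _), ae_all_iff.mpr h1, ae_all_iff.mpr h3,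
    ae_restrict_mem hΩ] with x hx1 hx2 hx3 hxΩ
  rw [hx1, Finset.sum_apply]
  simp only [hx3, hx2]
  rw [Finset.sum_eq_single_of_mem _ (mem_gridIndices hδ (mem_closedBall_zero_iff.mp (hR hxΩ)))]
  · have : x ∈ gridCube δ fun i => ⌊x i / δ⌋ := fun i => rfl
    simp [this]
  · intro k _ hk
    have : x ∉ gridCube δ k := fun h => hk (funext fun i => (h i).symm)
    simp [this]

theorem norm_sub_cubeAverage_sq_le [IsFiniteMeasure (volume.restrict Ω)] (hΩ : IsOpen Ω)
    {δ R : ℝ} (hδ : 0 < δ) (hR : Ω ⊆ Metric.closedBall 0 R) {w : H1 Ω} (hw : w ∈ H10 Ω) :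
    ‖fnL Ω w - cubeAverage Ω δ R (fnL Ω w)‖ ^ 2 ≤
      (gridConst d * ENNReal.ofReal δ ^ 2).toReal * ‖gradL Ω w‖ ^ 2 := by
  refine le_of_forall_testSubspace
    (F := fun w => ‖fnL Ω w - cubeAverage Ω δ R (fnL Ω w)‖ ^ 2)
    (G := fun w => (gridConst d * ENNReal.ofReal δ ^ 2).toReal * ‖gradL Ω w‖ ^ 2)
    (by fun_prop) (by fun_prop) ?_ hw
  rintro w ⟨φ, hφ, hwφ⟩
  replace hwφ : fnL Ω w =ᵐ[volume.restrict Ω] φ := hwφ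
  refine norm_sq_le_of_enorm_sq_le (ENNReal.mul_ne_top (gridConst_ne_top d) (by simp)) ?_
  rw [← lintegral_energyDensity_eq hΩ hφ hwφ]
  refine le_trans ?_ (lintegral_lintegral_translate_le hφ.contDiff_one hδ)
  rw [Lp.enorm_sq_eq_lintegral]
  refine le_trans (lintegral_mono_ae ?_) (setLIntegral_le_lintegral Ω _)
  have hint : Integrable φ := hφ.contDiff.continuous.integrable_of_hasCompactSupport
    hφ.hasCompactSupport
  filter_upwards [Lp.coeFn_sub (fnL Ω w) (cubeAverage Ω δ R (fnL Ω w)),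
    cubeAverage_ae_eq hΩ.measurableSet hδ hR (fnL Ω w), hwφ] with x hx1 hx2 h3
  rw [hx1, Pi.sub_apply, hx2, h3]
  have h4 : ∫ y in gridCube δ (fun i => ⌊x i / δ⌋), fnL Ω w y ∂volume.restrict Ω =
      ∫ y in gridCube δ (fun i => ⌊x i / δ⌋), φ y := by
    rw [setIntegral_congr_ae₀ (g := φ) (measurableSet_gridCube _ _).nullMeasurableSet
      (hwφ.mono fun y hy _ => hy), Measure.restrict_restrict (measurableSet_gridCube _ _),
      Set.inter_comm, ← Measure.restrict_restrict hΩ.measurableSet]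
    exact setIntegral_eq_integral_of_forall_compl_eq_zero fun y hy => hφ.eq_zero_of_notMem hy
  rw [h4]
  exact enorm_sub_average_sq_le hφ.contDiff.continuous hδ hint.integrableOn fun i => rfl

/-- **Rellich's theorem**: the inclusion `H¹₀(Ω) → L²(Ω)` is compact for bounded `Ω`. -/
theorem isCompactOperator_fnL_comp_subtypeL (hΩ : IsOpen Ω) (hb : Bornology.IsBounded Ω) :
    IsCompactOperator ((fnL Ω).comp (H10 Ω).subtypeL) := by
  have : IsFiniteMeasure (volume.restrict Ω) := ⟨by simpa using hb.measure_lt_top⟩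
  obtain ⟨R, hR⟩ := hb.subset_closedBall 0
  let ι : H10 Ω →L[ℂ] L2 Ω := (fnL Ω).comp (H10 Ω).subtypeL
  let δ : ℕ → ℝ := fun n => 1 / (n + 1)
  have hδ0 : Tendsto δ atTop (𝓝 0) := tendsto_one_div_add_atTop_nhds_zero_nat
  suffices key : Tendsto (fun n => (cubeAverage Ω (δ n) R).comp ι) atTop (𝓝 ι) from
    isCompactOperator_of_tendsto key
      (Eventually.of_forall fun n => (isCompactOperator_cubeAverage _ _).comp_clm ι)
  rw [tendsto_iff_norm_sub_tendsto_zero]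
  have hlim : Tendsto (fun n => √(gridConst d).toReal * δ n) atTop (𝓝 0) := by
    simpa using hδ0.const_mul √(gridConst d).toReal
  refine squeeze_zero (fun n => norm_nonneg _) (fun n => ?_) hlim
  have hδ : 0 < δ n := by positivity
  refine ContinuousLinearMap.opNorm_le_bound _ (by positivity) fun w => ?_
  have h1 := norm_sub_cubeAverage_sq_le hΩ hδ hR w.2
  have h2 := norm_sq_H1 (w : H1 Ω)
  refine le_of_sq_le_sq ?_ (by positivity)
  rw [sub_apply, norm_sub_rev]
  refine h1.trans ?_
  rw [ENNReal.toReal_mul, ENNReal.toReal_pow, ENNReal.toReal_ofReal hδ.le, mul_pow, mul_pow,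
    Real.sq_sqrt ENNReal.toReal_nonneg]
  have h3 : ‖w‖ = ‖(w : H1 Ω)‖ := rfl
  rw [h3, h2]
  gcongr
  nlinarith [sq_nonneg ‖fnL Ω (w : H1 Ω)‖]

end DirichletHelmholtz

/-! ### The operators of the weak formulation -/

section Multiplication
variable {α : Type*} [MeasurableSpace α] {μ : Measure α} {c : α → ℝ}

/-- Multiplication by an essentially bounded real function `c`, on complex `L²`. -/
noncomputable def mulL (hc : MemLp (fun x => (c x : ℂ)) ⊤ μ) : Lp ℂ 2 μ →L[ℂ] Lp ℂ 2 μ :=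
  (ContinuousLinearMap.mul ℂ ℂ).holderL μ ⊤ 2 2 hc.toLp

theorem mulL_ae_eq (hc : MemLp (fun x => (c x : ℂ)) ⊤ μ) (u : Lp ℂ 2 μ) :
    mulL hc u =ᵐ[μ] fun x => (c x : ℂ) * u x := by
  filter_upwards [(ContinuousLinearMap.mul ℂ ℂ).coeFn_holder (r := 2) hc.toLp u,
    hc.coeFn_toLp] with x hx hx'
  rw [← hx']
  exact hx

theorem inner_mulL_ae_eq (hc : MemLp (fun x => (c x : ℂ)) ⊤ μ) (u v : Lp ℂ 2 μ) :
    (fun x => inner ℂ (v x) (mulL hc u x)) =ᵐ[μ] fun x => (c x : ℂ) * u x * conj (v x) := by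
  filter_upwards [mulL_ae_eq hc u] with x hx
  rw [hx]; rfl

theorem inner_mulL (hc : MemLp (fun x => (c x : ℂ)) ⊤ μ) (u v : Lp ℂ 2 μ) :
    inner ℂ v (mulL hc u) = ∫ x, (c x : ℂ) * u x * conj (v x) ∂μ := by
  rw [L2.inner_def]
  exact integral_congr_ae (inner_mulL_ae_eq hc u v)

theorem integrable_inner_mulL (hc : MemLp (fun x => (c x : ℂ)) ⊤ μ) (u v : Lp ℂ 2 μ) :
    Integrable (fun x => (c x : ℂ) * u x * conj (v x)) μ :=
  (L2.integrable_inner v (mulL hc u)).congr (inner_mulL_ae_eq hc u v)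

theorem memLp_top_ofReal (hm : AEMeasurable c μ) {C : ℝ} (hC : ∀ᵐ x ∂μ, |c x| ≤ C) :
    MemLp (fun x => (c x : ℂ)) ⊤ μ :=
  memLp_top_of_bound hm.complex_ofReal.aestronglyMeasurable C (by simpa using hC)

theorem norm_sq_eq_integral {F : Type*} [NormedAddCommGroup F] [InnerProductSpace ℂ F]
    (f : Lp F 2 μ) : ‖f‖ ^ 2 = ∫ x, ‖f x‖ ^ 2 ∂μ := by
  rw [← inner_self_eq_norm_sq (𝕜 := ℂ), L2.inner_def, ← integral_re (L2.integrable_inner f f)]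
  simp only [inner_self_eq_norm_sq]

theorem integrable_norm_sq {F : Type*} [NormedAddCommGroup F] (f : Lp F 2 μ) :
    Integrable (fun x => ‖f x‖ ^ 2) μ :=
  (Lp.memLp f).integrable_norm_pow (by simp)

end Multiplication

theorem inner_sum_adjoint_comp {H K ι : Type*} [Fintype ι] [NormedAddCommGroup H]
    [InnerProductSpace ℂ H] [CompleteSpace H] [NormedAddCommGroup K] [InnerProductSpace ℂ K]
    [CompleteSpace K] (D : ι → H →L[ℂ] K) (M : ι → ι → K →L[ℂ] K) (u v : H) :
    inner ℂ v ((∑ i, ∑ j, (ContinuousLinearMap.adjoint (D i)).comp ((M i j).comp (D j)) :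
      H →L[ℂ] H) u) = ∑ i, ∑ j, inner ℂ (D i v) (M i j (D j u)) := by
  simp only [sum_apply, inner_sum, ContinuousLinearMap.comp_apply,
    ContinuousLinearMap.adjoint_inner_right]

section Matrix
variable {n : Type*} [Fintype n]

/-- The entries of a symmetric matrix with `0 ≤ ξ · M ξ ≤ C |ξ|²` are bounded by `C`: polarize,
testing with `eᵢ` and `eᵢ ± eⱼ`. -/
theorem abs_apply_le_of_quadraticForm_le [DecidableEq n] {M : Matrix n n ℝ} (hM : M.IsSymm) {C : ℝ}
    (h0 : ∀ ξ : EuclideanSpace ℝ n, 0 ≤ ∑ i, ∑ j, ξ i * M i j * ξ j)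
    (h1 : ∀ ξ : EuclideanSpace ℝ n, ∑ i, ∑ j, ξ i * M i j * ξ j ≤ C * ‖ξ‖ ^ 2) (i j : n) :
    |M i j| ≤ C := by
  have hdiag : ∀ i, M i i ≤ C := by
    intro i
    have := h1 (EuclideanSpace.single i 1)
    simpa [Pi.single_apply] using this
  have hpol : ∀ s : ℝ, 0 ≤ M i i + s * M i j + (s * M j i + s * M j j * s) := by
    intro s
    have := h0 (EuclideanSpace.single i 1 + s • EuclideanSpace.single j 1)
    simpa [Pi.single_apply, add_mul, mul_add, Finset.sum_add_distrib, mul_comm, add_assoc,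
      add_comm, add_left_comm] using this
  have hs := hM.apply i j
  have h2 := hpol 1
  have h3 := hpol (-1)
  rw [hs] at h2 h3
  rw [abs_le]
  constructor <;> linarith [hdiag i, hdiag j]

/-- A lower bound for a real quadratic form carries over to complex vectors, by separating real and
imaginary parts. -/
theorem le_re_sesquilinearForm {M : Matrix n n ℝ} {c : ℝ}
    (h : ∀ ξ : EuclideanSpace ℝ n, c * ‖ξ‖ ^ 2 ≤ ∑ i, ∑ j, ξ i * M i j * ξ j)
    (ζ : EuclideanSpace ℂ n) :
    c * ‖ζ‖ ^ 2 ≤ (∑ i, ∑ j, (M i j : ℂ) * ζ j * conj (ζ i)).re := by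
  have hr := h (WithLp.toLp 2 fun i => (ζ i).re)
  have hi := h (WithLp.toLp 2 fun i => (ζ i).im)
  simp only [EuclideanSpace.norm_sq_eq, Real.norm_eq_abs, sq_abs] at hr hi
  have h1 : ‖ζ‖ ^ 2 = ∑ i, (ζ i).re ^ 2 + ∑ i, (ζ i).im ^ 2 := by
    rw [EuclideanSpace.norm_sq_eq, ← Finset.sum_add_distrib]
    refine Finset.sum_congr rfl fun i _ => ?_
    rw [Complex.sq_norm, Complex.normSq_apply]; ring
  have h2 : (∑ i, ∑ j, (M i j : ℂ) * ζ j * conj (ζ i)).re =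
      ∑ i, ∑ j, (ζ i).re * M i j * (ζ j).re + ∑ i, ∑ j, (ζ i).im * M i j * (ζ j).im := by
    simp only [Complex.re_sum, ← Finset.sum_add_distrib]
    refine Finset.sum_congr rfl fun i _ => Finset.sum_congr rfl fun j _ => ?_
    simp
    ring
  rw [h1, h2, mul_add]
  exact add_le_add hr hi

end Matrix

namespace DirichletHelmholtz

variable {d : ℕ} {Ω : Set (EuclideanSpace ℝ (Fin d))}

theorem IsTestFunction.exists_fn_ae_eq {φ : EuclideanSpace ℝ (Fin d) → ℂ}
    (h : IsTestFunction Ω φ) : ∃ u : H10 Ω, fn u =ᵐ[volume.restrict Ω] φ := by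
  let G : EuclideanSpace ℝ (Fin d) → EuclideanSpace ℂ (Fin d) :=
    fun x => WithLp.toLp 2 fun i => partialDeriv i φ x
  have hGc : Continuous G :=
    (PiLp.continuous_toLp 2 _).comp (continuous_pi fun i => h.continuous_partialDeriv i)
  have hGs : HasCompactSupport G := by
    refine HasCompactSupport.intro h.hasCompactSupport fun x hx => ?_
    have h1 : fderiv ℝ φ x = 0 := image_eq_zero_of_notMem_tsupport fun hx' =>
      hx (tsupport_fderiv_subset ℝ hx')
    ext i
    simp [G, partialDeriv, h1]
  have hG : MemLp G 2 (volume.restrict Ω) := (hGc.memLp_of_hasCompactSupport hGs).restrict Ω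
  have hw : WithLp.toLp 2 (h.memLp.toLp, hG.toLp) ∈ H1 Ω := by
    intro ψ hψ i
    have h1 : ∫ x in Ω, h.memLp.toLp φ x * partialDeriv i ψ x =
        ∫ x in Ω, φ x * partialDeriv i ψ x :=
      integral_congr_ae (by filter_upwards [h.memLp.coeFn_toLp] with x hx; rw [hx])
    have h2 : ∫ x in Ω, hG.toLp G x i * ψ x = ∫ x in Ω, partialDeriv i φ x * ψ x :=
      integral_congr_ae (by filter_upwards [hG.coeFn_toLp] with x hx; rw [hx])
    refine h1.trans ?_
    rw [h.setIntegral_mul_partialDeriv hψ, ← h2]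
    rfl
  exact ⟨⟨⟨_, hw⟩, subset_closure ⟨φ, h, h.memLp.coeFn_toLp⟩⟩, h.memLp.coeFn_toLp⟩

theorem exists_isTestFunction_ne_zero {U : Set (EuclideanSpace ℝ (Fin d))} (hU : IsOpen U)
    (hne : U.Nonempty) :
    ∃ φ : EuclideanSpace ℝ (Fin d) → ℂ, IsTestFunction U φ ∧ φ ≠ 0 := by
  obtain ⟨x, hx⟩ := hne
  obtain ⟨f, hf1, hf2, hf3, -, hfx⟩ := exists_contDiff_tsupport_subset (n := ⊤) (hU.mem_nhds hx)
  refine ⟨fun x => (f x : ℂ), ⟨Complex.ofRealCLM.contDiff.comp hf3,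
    hf2.comp_left (g := fun r : ℝ => (r : ℂ)) (by simp),
    (closure_mono (Function.support_comp_subset (g := fun r : ℝ => (r : ℂ)) (by simp) f)).trans
      hf1⟩, fun h => ?_⟩
  have := congrFun h x
  simp [hfx] at this

/-- Test functions supported in disjoint open subsets of `Ω` are orthogonal in `L²(Ω)`. -/
theorem not_finiteDimensional_H10 (hd : 1 ≤ d) (hΩ : IsOpen Ω) (hne : Ω.Nonempty) :
    ¬ FiniteDimensional ℂ (H10 Ω) := by
  intro hfin
  have : Nonempty (Fin d) := ⟨⟨0, hd⟩⟩
  obtain ⟨x₀, hx₀⟩ := hne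
  have : Infinite Ω := (infinite_of_mem_nhds x₀ (hΩ.mem_nhds hx₀)).to_subtype
  obtain ⟨U, hUinf, hUo, hUd⟩ := exists_seq_infinite_isOpen_pairwise_disjoint Ω
  have hV : ∀ n, ∃ φ, IsTestFunction (Subtype.val '' U n) φ ∧ φ ≠ 0 := fun n =>
    exists_isTestFunction_ne_zero (hΩ.isOpenMap_subtype_val _ (hUo n)) ((hUinf n).nonempty.image _)
  choose φ hφ hφ0 using hV
  have hsub : ∀ n, Subtype.val '' U n ⊆ Ω := fun n => by rintro _ ⟨y, -, rfl⟩; exact y.2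
  have hφΩ : ∀ n, IsTestFunction Ω (φ n) := fun n =>
    ⟨(hφ n).contDiff, (hφ n).hasCompactSupport, (hφ n).tsupport_subset.trans (hsub n)⟩
  choose u hu using fun n => (hφΩ n).exists_fn_ae_eq
  have horth : Pairwise fun m n => inner ℂ (fn (u m)) (fn (u n)) = 0 := by
    intro m n hmn
    rw [L2.inner_def]
    refine integral_eq_zero_of_ae ?_
    filter_upwards [hu m, hu n] with x hm hn
    rw [hm, hn]
    by_cases hx : x ∈ Subtype.val '' U m
    · have : x ∉ Subtype.val '' U n := by
        rintro ⟨y, hy, rfl⟩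
        obtain ⟨z, hz, hzy⟩ := hx
        exact Set.disjoint_left.mp (hUd hmn) hz (Subtype.ext hzy ▸ hy)
      simp [(hφ n).eq_zero_of_notMem this]
    · simp [(hφ m).eq_zero_of_notMem hx]
  have hne0 : ∀ n, fn (u n) ≠ 0 := by
    intro n h0
    apply hφ0 n
    have h1 : φ n =ᵐ[volume.restrict Ω] 0 := by
      refine (hu n).symm.trans ?_
      rw [h0]; exact Lp.coeFn_zero _ _ _
    have h2 : φ n =ᵐ[volume] 0 := by
      rw [Filter.EventuallyEq, ae_restrict_iff' hΩ.measurableSet] at h1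
      filter_upwards [h1] with x hx
      by_cases hxΩ : x ∈ Ω
      · exact hx hxΩ
      · exact (hφΩ n).eq_zero_of_notMem hxΩ
    exact (Continuous.ae_eq_iff_eq volume (hφ n).contDiff.continuous continuous_const).mp h2
  have hli : LinearIndependent ℂ fun n => fn (u n) :=
    linearIndependent_of_ne_zero_of_inner_eq_zero hne0 horth
  have hli' : LinearIndependent ℂ u :=
    LinearIndependent.of_comp ((fnL Ω).comp (H10 Ω).subtypeL).toLinearMap hli
  exact Infinite.not_finite hli'.finite

/-- The inclusion `H¹₀(Ω) → L²(Ω)`. -/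
noncomputable def inclL (Ω : Set (EuclideanSpace ℝ (Fin d))) : H10 Ω →L[ℂ] L2 Ω :=
  (fnL Ω).comp (H10 Ω).subtypeL

/-- The weak partial derivative `∂ᵢ : H¹₀(Ω) → L²(Ω)`. -/
noncomputable def partialL (Ω : Set (EuclideanSpace ℝ (Fin d))) (i : Fin d) : H10 Ω →L[ℂ] L2 Ω :=
  ((coordL Ω i).comp (gradL Ω)).comp (H10 Ω).subtypeL

theorem partialL_ae_eq (i : Fin d) (u : H10 Ω) :
    partialL Ω i u =ᵐ[volume.restrict Ω] fun x => grad u x i :=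
  coordL_ae_eq i (grad u)

/-- The operator on `H¹₀(Ω)` that represents the form `∫ q u conj v`. -/
noncomputable def massOp {q : EuclideanSpace ℝ (Fin d) → ℝ}
    (hq : MemLp (fun x => (q x : ℂ)) ⊤ (volume.restrict Ω)) : H10 Ω →L[ℂ] H10 Ω :=
  (ContinuousLinearMap.adjoint (inclL Ω)).comp ((mulL hq).comp (inclL Ω))

theorem inner_massOp {q : EuclideanSpace ℝ (Fin d) → ℝ}
    (hq : MemLp (fun x => (q x : ℂ)) ⊤ (volume.restrict Ω)) (u v : H10 Ω) :
    inner ℂ v (massOp hq u) = ∫ x in Ω, (q x : ℂ) * fn u x * conj (fn v x) := by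
  rw [massOp, ContinuousLinearMap.comp_apply, ContinuousLinearMap.adjoint_inner_right]
  exact inner_mulL hq (fn u) (fn v)

/-- The operator on `H¹₀(Ω)` that represents the energy form `∫ a ∇u · conj ∇v`. -/
noncomputable def stiffnessOp {a : EuclideanSpace ℝ (Fin d) → Matrix (Fin d) (Fin d) ℝ}
    (ha : ∀ i j, MemLp (fun x => (a x i j : ℂ)) ⊤ (volume.restrict Ω)) : H10 Ω →L[ℂ] H10 Ω :=
  ∑ i, ∑ j, (ContinuousLinearMap.adjoint (partialL Ω i)).comp ((mulL (ha i j)).comp (partialL Ω j))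

theorem integrable_energy {a : EuclideanSpace ℝ (Fin d) → Matrix (Fin d) (Fin d) ℝ}
    (ha : ∀ i j, MemLp (fun x => (a x i j : ℂ)) ⊤ (volume.restrict Ω)) (u v : H10 Ω) (i j : Fin d) :
    Integrable (fun x => (a x i j : ℂ) * grad u x j * conj (grad v x i)) (volume.restrict Ω) := by
  refine (integrable_inner_mulL (ha i j) (partialL Ω j u) (partialL Ω i v)).congr ?_
  filter_upwards [partialL_ae_eq i v, partialL_ae_eq j u] with x h1 h2
  rw [h1, h2]

theorem inner_stiffnessOp {a : EuclideanSpace ℝ (Fin d) → Matrix (Fin d) (Fin d) ℝ}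
    (ha : ∀ i j, MemLp (fun x => (a x i j : ℂ)) ⊤ (volume.restrict Ω)) (u v : H10 Ω) :
    inner ℂ v (stiffnessOp ha u) =
      ∫ x in Ω, ∑ i, ∑ j, (a x i j : ℂ) * grad u x j * conj (grad v x i) := by
  have h1 : inner ℂ v (stiffnessOp ha u) =
      ∑ i, ∑ j, inner ℂ (partialL Ω i v) (mulL (ha i j) (partialL Ω j u)) :=
    inner_sum_adjoint_comp (partialL Ω) (fun i j => mulL (ha i j)) u v
  rw [h1, integral_finsetSum _ fun i _ => integrable_finsetSum _ fun j _ =>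
    integrable_energy ha u v i j]
  refine Finset.sum_congr rfl fun i _ => ?_
  rw [integral_finsetSum _ fun j _ => integrable_energy ha u v i j]
  refine Finset.sum_congr rfl fun j _ => ?_
  rw [inner_mulL]
  refine integral_congr_ae ?_
  filter_upwards [partialL_ae_eq i v, partialL_ae_eq j u] with x h1 h2
  rw [h1, h2]

theorem isWeakSolution_iff {a : EuclideanSpace ℝ (Fin d) → Matrix (Fin d) (Fin d) ℝ}
    (ha : ∀ i j, MemLp (fun x => (a x i j : ℂ)) ⊤ (volume.restrict Ω))
    {q : EuclideanSpace ℝ (Fin d) → ℝ}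
    (hq : MemLp (fun x => (q x : ℂ)) ⊤ (volume.restrict Ω)) {k : ℂ} {f : HMinusOne Ω}
    {u : H10 Ω} :
    IsWeakSolution Ω a q k f u ↔
      ∀ v, inner ℂ v ((stiffnessOp ha - k • massOp hq) u) = f v := by
  refine forall_congr' fun v => ?_
  rw [inner_pencil, inner_stiffnessOp, inner_massOp]

theorem dirichletEigenvalues_eq {a : EuclideanSpace ℝ (Fin d) → Matrix (Fin d) (Fin d) ℝ}
    (ha : ∀ i j, MemLp (fun x => (a x i j : ℂ)) ⊤ (volume.restrict Ω))
    {q : EuclideanSpace ℝ (Fin d) → ℝ}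
    (hq : MemLp (fun x => (q x : ℂ)) ⊤ (volume.restrict Ω)) :
    dirichletEigenvalues Ω a q = pencilEigenvalues (stiffnessOp ha) (massOp hq) := by
  have hiff : ∀ (k : ℂ) (u : H10 Ω),
      IsWeakSolution Ω a q k 0 u ↔ stiffnessOp ha u = k • massOp hq u := fun k u =>
    (isWeakSolution_iff ha hq).trans (forall_inner_pencil_eq_zero_iff _ _ k u)
  simp only [dirichletEigenvalues, pencilEigenvalues, hiff]

theorem isSymmetric_stiffnessOp {a : EuclideanSpace ℝ (Fin d) → Matrix (Fin d) (Fin d) ℝ}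
    (ha : ∀ i j, MemLp (fun x => (a x i j : ℂ)) ⊤ (volume.restrict Ω))
    (hsymm : ∀ᵐ x ∂volume.restrict Ω, (a x).IsSymm) : (stiffnessOp ha).IsSymmetric := by
  intro u v
  change inner ℂ (stiffnessOp ha u) v = inner ℂ u (stiffnessOp ha v)
  rw [← inner_conj_symm, inner_stiffnessOp, inner_stiffnessOp, ← integral_conj]
  refine integral_congr_ae ?_
  filter_upwards [hsymm] with x hx
  simp only [map_sum, map_mul, Complex.conj_ofReal, Complex.conj_conj]
  rw [Finset.sum_comm]
  refine Finset.sum_congr rfl fun i _ => Finset.sum_congr rfl fun j _ => ?_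
  rw [hx.apply]; ring

theorem le_re_inner_stiffnessOp {a : EuclideanSpace ℝ (Fin d) → Matrix (Fin d) (Fin d) ℝ}
    (ha : ∀ i j, MemLp (fun x => (a x i j : ℂ)) ⊤ (volume.restrict Ω)) {lam : ℝ}
    (hell : ∀ᵐ x ∂volume.restrict Ω, ∀ ξ : EuclideanSpace ℝ (Fin d),
      lam * ‖ξ‖ ^ 2 ≤ ∑ i, ∑ j, ξ i * a x i j * ξ j) (u : H10 Ω) :
    lam * ‖grad u‖ ^ 2 ≤ (inner ℂ u (stiffnessOp ha u)).re := by
  have hint : Integrable (fun x => ∑ i, ∑ j, (a x i j : ℂ) * grad u x j * conj (grad u x i))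
      (volume.restrict Ω) := integrable_finsetSum _ fun i _ => integrable_finsetSum _ fun j _ =>
    integrable_energy ha u u i j
  have h1 := integral_re hint
  rw [inner_stiffnessOp, norm_sq_eq_integral, ← integral_const_mul]
  refine le_trans ?_ h1.le
  refine integral_mono_ae ((integrable_norm_sq _).const_mul _) hint.re ?_
  filter_upwards [hell] with x hx
  exact le_re_sesquilinearForm hx (grad u x)

theorem exists_coercive_stiffnessOp (hd : 1 ≤ d) (hΩ : IsOpen Ω) (hb : Bornology.IsBounded Ω)
    {a : EuclideanSpace ℝ (Fin d) → Matrix (Fin d) (Fin d) ℝ}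
    (ha : ∀ i j, MemLp (fun x => (a x i j : ℂ)) ⊤ (volume.restrict Ω)) {lam : ℝ} (hlam : 0 < lam)
    (hell : ∀ᵐ x ∂volume.restrict Ω, ∀ ξ : EuclideanSpace ℝ (Fin d),
      lam * ‖ξ‖ ^ 2 ≤ ∑ i, ∑ j, ξ i * a x i j * ξ j) :
    ∃ c : ℝ, 0 < c ∧ ∀ u : H10 Ω, c * ‖u‖ ^ 2 ≤ (inner ℂ u (stiffnessOp ha u)).re := by
  obtain ⟨C, hC0, hC⟩ := exists_poincare hd hΩ hb
  refine ⟨lam / (C + 1), by positivity, fun u => ?_⟩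
  have h1 : ‖u‖ ^ 2 = ‖fn u‖ ^ 2 + ‖grad u‖ ^ 2 := norm_sq_H1 (u : H1 Ω)
  have h2 : ‖fn u‖ ^ 2 ≤ C * ‖grad u‖ ^ 2 := hC _ u.2
  refine le_trans ?_ (le_re_inner_stiffnessOp ha hell u)
  rw [div_mul_eq_mul_div, div_le_iff₀ (by positivity), mul_assoc]
  gcongr
  linarith

theorem isSymmetric_massOp {q : EuclideanSpace ℝ (Fin d) → ℝ}
    (hq : MemLp (fun x => (q x : ℂ)) ⊤ (volume.restrict Ω)) : (massOp hq).IsSymmetric := by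
  intro u v
  change inner ℂ (massOp hq u) v = inner ℂ u (massOp hq v)
  rw [← inner_conj_symm, inner_massOp, inner_massOp, ← integral_conj]
  refine integral_congr_ae (Eventually.of_forall fun x => ?_)
  simp only [map_mul, Complex.conj_ofReal, Complex.conj_conj]
  ring

theorem le_re_inner_massOp {q : EuclideanSpace ℝ (Fin d) → ℝ}
    (hq : MemLp (fun x => (q x : ℂ)) ⊤ (volume.restrict Ω)) {β : ℝ}
    (hβ : ∀ᵐ x ∂volume.restrict Ω, β ≤ q x) (u : H10 Ω) :
    β * ‖fn u‖ ^ 2 ≤ (inner ℂ u (massOp hq u)).re := by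
  have hint := integrable_inner_mulL hq (fn u) (fn u)
  have h1 := integral_re hint
  rw [inner_massOp, norm_sq_eq_integral, ← integral_const_mul]
  refine le_trans ?_ h1.le
  refine integral_mono_ae ((integrable_norm_sq _).const_mul _) hint.re ?_
  filter_upwards [hβ] with x hx
  have : RCLike.re ((q x : ℂ) * fn u x * conj (fn u x)) = q x * ‖fn u x‖ ^ 2 := by
    rw [mul_assoc, Complex.mul_conj, Complex.normSq_eq_norm_sq, ← Complex.ofReal_mul]
    rfl
  rw [this]
  gcongr

theorem isCompactOperator_massOp (hΩ : IsOpen Ω) (hb : Bornology.IsBounded Ω)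
    {q : EuclideanSpace ℝ (Fin d) → ℝ}
    (hq : MemLp (fun x => (q x : ℂ)) ⊤ (volume.restrict Ω)) : IsCompactOperator (massOp hq) :=
  ((isCompactOperator_fnL_comp_subtypeL hΩ hb).clm_comp (mulL hq)).clm_comp
    (ContinuousLinearMap.adjoint (inclL Ω))

theorem massOp_injective (hΩ : IsOpen Ω) {q : EuclideanSpace ℝ (Fin d) → ℝ}
    (hq : MemLp (fun x => (q x : ℂ)) ⊤ (volume.restrict Ω)) {β : ℝ} (hβ0 : 0 < β)
    (hβ : ∀ᵐ x ∂volume.restrict Ω, β ≤ q x) : Function.Injective (massOp hq) := by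
  rw [injective_iff_map_eq_zero]
  intro u hu
  have h1 := le_re_inner_massOp hq hβ u
  rw [hu, inner_zero_right, Complex.zero_re] at h1
  have h2 : ‖fn u‖ ^ 2 ≤ 0 := by nlinarith
  have h3 : fn u = 0 := by simpa using le_antisymm h2 (sq_nonneg _)
  have h4 : fnL Ω (u : H1 Ω) = fnL Ω 0 := by rw [map_zero]; exact h3
  exact Subtype.ext (fnL_injective hΩ h4)

end DirichletHelmholtz

/-! ### The Dirichlet problem -/

theorem proposition3p1 {d : ℕ} (hd : 1 ≤ d)
    (Ω : Set (EuclideanSpace ℝ (Fin d))) (hΩ_open : IsOpen Ω) (hΩ_ne : Ω.Nonempty)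
    (hΩ_bdd : Bornology.IsBounded Ω)
    (a : EuclideanSpace ℝ (Fin d) → Matrix (Fin d) (Fin d) ℝ)
    (ha_meas : ∀ i j, AEMeasurable (fun x => a x i j) (volume.restrict Ω))
    (ha_symm : ∀ᵐ x ∂volume.restrict Ω, (a x).IsSymm)
    (lam Lam : ℝ) (hlam : 0 < lam) (hLam : 0 < Lam)
    (ha_ell : ∀ᵐ x ∂volume.restrict Ω, ∀ ξ : EuclideanSpace ℝ (Fin d),
      lam * ‖ξ‖ ^ 2 ≤ ∑ i, ∑ j, ξ i * a x i j * ξ j ∧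
      ∑ i, ∑ j, ξ i * a x i j * ξ j ≤ Lam * ‖ξ‖ ^ 2)
    (q : EuclideanSpace ℝ (Fin d) → ℝ) (hq_meas : AEMeasurable q (volume.restrict Ω))
    (β₁ β₂ : ℝ) (hβ₁ : 0 < β₁) (hβ₂ : 0 < β₂)
    (hq : ∀ᵐ x ∂volume.restrict Ω, β₁ ≤ q x ∧ q x ≤ β₂) :
    ∃ ev : ℕ → ℝ,
      (∀ i, 0 < ev i) ∧
      Tendsto ev atTop atTop ∧
      DirichletHelmholtz.dirichletEigenvalues Ω a q = Set.range (fun i => (ev i : ℂ)) ∧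
      (∀ k : ℂ, k ∉ Set.range (fun i => (ev i : ℂ)) →
        ∃ C : ℝ, 0 < C ∧ ∀ f : DirichletHelmholtz.HMinusOne Ω,
          ∃ u : DirichletHelmholtz.H10 Ω,
            DirichletHelmholtz.IsWeakSolution Ω a q k f u ∧
            (∀ v : DirichletHelmholtz.H10 Ω,
              DirichletHelmholtz.IsWeakSolution Ω a q k f v → v = u) ∧
            ‖u‖ ≤ C * ‖f‖) ∧
      (∀ (f : DirichletHelmholtz.HMinusOne Ω) (U : ℂ → DirichletHelmholtz.H10 Ω),
        (∀ k : ℂ, k ∉ Set.range (fun i => (ev i : ℂ)) →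
          DirichletHelmholtz.IsWeakSolution Ω a q k f (U k)) →
        AnalyticOnNhd ℂ U (Set.range (fun i => (ev i : ℂ)))ᶜ) := by
  have ha : ∀ i j, MemLp (fun x => (a x i j : ℂ)) ⊤ (volume.restrict Ω) := fun i j =>
    memLp_top_ofReal (ha_meas i j) (C := Lam) (by
      filter_upwards [ha_symm, ha_ell] with x hs he
      exact abs_apply_le_of_quadraticForm_le hs
        (fun ξ => le_trans (by positivity) (he ξ).1) (fun ξ => (he ξ).2) i j)
  have hqL : MemLp (fun x => (q x : ℂ)) ⊤ (volume.restrict Ω) :=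
    memLp_top_ofReal hq_meas (C := β₂) (by
      filter_upwards [hq] with x hx
      rw [abs_of_pos (hβ₁.trans_le hx.1)]
      exact hx.2)
  obtain ⟨c, hc, hcoer⟩ := DirichletHelmholtz.exists_coercive_stiffnessOp hd hΩ_open hΩ_bdd ha hlam
    (ha_ell.mono fun x hx ξ => (hx ξ).1)
  have hqβ : ∀ᵐ x ∂volume.restrict Ω, β₁ ≤ q x := hq.mono fun x hx => hx.1
  open scoped DirichletHelmholtz in
  obtain ⟨ev, hev0, hevt, hev, hsol, han⟩ := exists_spectral_alternative
    (DirichletHelmholtz.not_finiteDimensional_H10 hd hΩ_open hΩ_ne)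
    (DirichletHelmholtz.isSymmetric_stiffnessOp ha ha_symm) hc hcoer
    (DirichletHelmholtz.isSymmetric_massOp hqL)
    (fun u => le_trans (by positivity) (DirichletHelmholtz.le_re_inner_massOp hqL hqβ u))
    (DirichletHelmholtz.isCompactOperator_massOp hΩ_open hΩ_bdd hqL)
    (DirichletHelmholtz.massOp_injective hΩ_open hqL hβ₁ hqβ)
  simp only [DirichletHelmholtz.isWeakSolution_iff ha hqL]
  exact ⟨ev, hev0, hevt, (DirichletHelmholtz.dirichletEigenvalues_eq ha hqL).trans hev, hsol, han⟩
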